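/- **Theorem 1.** For $a\in\mathbb R^3$ let $a^\times$ be the skew-symmetric matrix with $a^\times b=a\times b$. For $q=(q_v,q_4)\in\mathbb R^3\times\mathbb R$ put $$A(q)=(q_4^2-q_v^Tq_v)I+2q_vq_v^T-2q_4q_v^\times,\qquad W(q)=\tfrac12\begin{bmatrix}q_4I+q_v^\times\\-q_v^T\end{bmatrix}.$$ Let $B^i(t)$ be the dipole geomagnetic field along a circular orbit, $$B^i(t)=\frac{\mu_m}{\|r(t)\|^3}\bigl[3(\hat m(t)^T\hat r(t))\hat r(t)-\hat m(t)\bigr],\qquad \hat r=\frac{r}{\|r\|},$$ where $\mu_m>0$, $\hat m(t)=(\sin\theta_m\cos(\omega_et+\alpha_0),\ \sin\theta_m\sin(\omega_et+\alpha_0),\ \cos\theta_m)^T$, and $r(t)$ is obtained from $(R\cos(nt+\phi_0),R\sin(nt+\phi_0),0)^T$, $R>0$, by rotating it by the inclination about the first axis and then by the right ascension of the ascending node about the third axis; the angles and rates are arbitrary real numbers. Put $\Gamma^i(t)=B^i(t)^\times (B^i(t)^\times)^T$. The average $$\Gamma^i_{av}=\lim_{T\to\infty}\frac1T\int_0^T\Gamma^i(\tau)\,d\tau$$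 exists; assume that it is positive definite. Let $k_1,k_2>0$ and $0<J_{\min}\le J_{\max}$. Then there is $\epsilon^*>0$, which may depend on all the preceding data but not on $J$, such that for every $0<\epsilon<\epsilon^*$ there are $c,k,\gamma>0$ with the following property. For every symmetric $J\in\mathbb R^{3\times3}$ with $J_{\min}\le\lambda_{\min}(J)\le\lambda_{\max}(J)\le J_{\max}$, the equilibrium $(q,\omega)=(\bar q,0)$, $\bar q=(0,0,0,1)^T$, of the closed-loop system $$\dot q=W(q)\omega,\qquad J\dot\omega=-\omega^\times J\omega+A(q)\Gamma^i(t)A(q)^Tu,\qquad u=-(\epsilon^2k_1q_v+\epsilon k_2\omega),$$ with $\|q\|=1$, is locally exponentially stable with these constants: for all $t_0\ge0$ and all initial states $(q_0,\omega_0)$ at time $t_0$ with $\|q_0\|=1$ and $\max(\|q_0-\bar q\|,\|\omega_0\|)<c$, a solution exists and satisfies $\|q(t)\|=1$ for all $t\ge t_0$, and every solution satisfies $$\max(\|q(t)-\bar q\|,\|\omega(t)\|)\le k\,\max(\|q_0-\bar q\|,\|\omega_0\|)\,e^{-\gamma(t-t_0)}$$ for as long as it is defined. -/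

import Mathlib

open Filter Topology Matrix

/-- The skew-symmetric matrix `a^×` of `a ∈ ℝ³`, so that `a^× b` is the cross product `a × b`. -/
def skewMat (a : Fin 3 → ℝ) : Matrix (Fin 3) (Fin 3) ℝ :=
  !![0, -a 2, a 1;
     a 2, 0, -a 0;
     -a 1, a 0, 0]

/-- Vector part `q_v = (q₁, q₂, q₃)` of the quaternion `q = (q₁, q₂, q₃, q₄)`. -/
def quatVec (q : EuclideanSpace ℝ (Fin 4)) : Fin 3 → ℝ := ![q 0, q 1, q 2]

/-- The attitude matrix `A(q) = (q₄² - q_vᵀ q_v) I + 2 q_v q_vᵀ - 2 q₄ q_v^×`. -/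
def attitudeMat (q : EuclideanSpace ℝ (Fin 4)) : Matrix (Fin 3) (Fin 3) ℝ :=
  (q 3 ^ 2 - quatVec q ⬝ᵥ quatVec q) • (1 : Matrix (Fin 3) (Fin 3) ℝ)
    + (2 : ℝ) • vecMulVec (quatVec q) (quatVec q)
    - (2 * q 3) • skewMat (quatVec q)

/-- The kinematic matrix `W(q) = (1/2) [q₄ I + q_v^× ; -q_vᵀ]`: the first three rows are
`q₄ I + q_v^×` and the last row is `-q_vᵀ`, all of it halved. -/
noncomputable def kinMat (q : EuclideanSpace ℝ (Fin 4)) : Matrix (Fin 4) (Fin 3) ℝ :=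
  (1 / 2 : ℝ) •
    !![q 3, -q 2, q 1;
       q 2, q 3, -q 0;
       -q 1, q 0, q 3;
       -q 0, -q 1, -q 2]

/-- Parameters of the tilted-dipole geomagnetic field along a circular orbit. -/
structure OrbitField where
  /-- total dipole strength `μ_m` -/
  dipole : ℝ
  /-- coelevation `θ_m` of the dipole -/
  coelev : ℝ
  /-- Earth's rotation rate `ω_e` -/
  earthRate : ℝ
  /-- right ascension `α₀` of the dipole at time `0` -/
  ascDipole : ℝ
  /-- orbit radius `R` -/
  radius : ℝ
  /-- orbital rate `n` -/
  orbRate : ℝ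
  /-- initial phase `φ₀` on the orbit -/
  phase : ℝ
  /-- orbit inclination -/
  incl : ℝ
  /-- right ascension of the ascending node -/
  node : ℝ

namespace OrbitField

/-- Direction cosines `m̂ⁱ(t)` of the Earth's magnetic dipole in the inertial frame. -/
noncomputable def dipoleDir (p : OrbitField) (t : ℝ) : EuclideanSpace ℝ (Fin 3) :=
  !₂[Real.sin p.coelev * Real.cos (p.earthRate * t + p.ascDipole),
     Real.sin p.coelev * Real.sin (p.earthRate * t + p.ascDipole),
     Real.cos p.coelev]

/-- First coordinate of the spacecraft in the orbital plane. -/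
noncomputable def xp (p : OrbitField) (t : ℝ) : ℝ :=
  p.radius * Real.cos (p.orbRate * t + p.phase)

/-- Second coordinate of the spacecraft in the orbital plane. -/
noncomputable def yp (p : OrbitField) (t : ℝ) : ℝ :=
  p.radius * Real.sin (p.orbRate * t + p.phase)

/-- The spacecraft position `rⁱ(t)` in the inertial frame: the vector `(xp, yp, 0)` is rotated
by the inclination about the first axis and then by the right ascension of the ascending node
about the third axis. -/
noncomputable def position (p : OrbitField) (t : ℝ) : EuclideanSpace ℝ (Fin 3) :=
  !₂[Real.cos p.node * p.xp t - Real.sin p.node * Real.cos p.incl * p.yp t,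
     Real.sin p.node * p.xp t + Real.cos p.node * Real.cos p.incl * p.yp t,
     Real.sin p.incl * p.yp t]

/-- Direction cosines `r̂ⁱ(t)` of the position. -/
noncomputable def positionDir (p : OrbitField) (t : ℝ) : EuclideanSpace ℝ (Fin 3) :=
  ‖p.position t‖⁻¹ • p.position t

/-- The dipole geomagnetic field at the spacecraft in the inertial frame,
`Bⁱ = μ_m / ‖r‖³ (3 (m̂ᵀ r̂) r̂ - m̂)`. -/
noncomputable def field (p : OrbitField) (t : ℝ) : EuclideanSpace ℝ (Fin 3) :=
  (p.dipole / ‖p.position t‖ ^ 3) •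
    ((3 * inner ℝ (p.dipoleDir t) (p.positionDir t)) • p.positionDir t - p.dipoleDir t)

/-- `Γⁱ(t) = Bⁱ(t)^× (Bⁱ(t)^×)ᵀ`. -/
noncomputable def gamma (p : OrbitField) (t : ℝ) : Matrix (Fin 3) (Fin 3) ℝ :=
  skewMat (p.field t) * (skewMat (p.field t))ᵀ

/-- The finite-horizon average `(1/T) ∫₀ᵀ Γⁱ(τ) dτ`, entry by entry. -/
noncomputable def gammaMean (p : OrbitField) (T : ℝ) : Matrix (Fin 3) (Fin 3) ℝ :=
  Matrix.of fun i j => (1 / T) * ∫ τ in (0 : ℝ)..T, p.gamma τ i j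

end OrbitField

/-- `J` is symmetric and all its eigenvalues lie in `[Jmin, Jmax]`. -/
def InertiaBounds (Jmin Jmax : ℝ) (J : Matrix (Fin 3) (Fin 3) ℝ) : Prop :=
  ∃ hJ : J.IsHermitian, ∀ i, Jmin ≤ hJ.eigenvalues i ∧ hJ.eigenvalues i ≤ Jmax

/-- The states `(q, ω)`. The norm of this product is the larger of the two Euclidean norms, which
is equivalent to the Euclidean norm of `ℝ⁷`. -/
abbrev AttState : Type := EuclideanSpace ℝ (Fin 4) × EuclideanSpace ℝ (Fin 3)

/-- The attitude equations with inertia matrix `J`, matrix function `Γ` and control `u`, as a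
relation between the time, the state `x = (q, ω)` and its time derivative `v`:
`q' = W(q) ω` and `J ω' = -ω^× J ω + A(q) Γ(t) A(q)ᵀ u`. -/
def attitudeEqs (J : Matrix (Fin 3) (Fin 3) ℝ) (Γ : ℝ → Matrix (Fin 3) (Fin 3) ℝ)
    (u : Fin 3 → ℝ) (t : ℝ) (x v : AttState) : Prop :=
  v.1.ofLp = kinMat x.1 *ᵥ x.2.ofLp ∧
  J *ᵥ v.2.ofLp = -(skewMat x.2 *ᵥ (J *ᵥ x.2.ofLp))
    + (attitudeMat x.1 * Γ t * (attitudeMat x.1)ᵀ) *ᵥ u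

/-- The proportional derivative law `u = -(ε² k₁ q_v + ε k₂ ω)`. -/
def pdLaw (k₁ k₂ ε : ℝ) (x : AttState) : Fin 3 → ℝ :=
  -((ε ^ 2 * k₁) • quatVec x.1 + (ε * k₂) • x.2.ofLp)

/-- The attitude equations in closed loop with the proportional derivative law. -/
def closedLoop (J : Matrix (Fin 3) (Fin 3) ℝ) (Γ : ℝ → Matrix (Fin 3) (Fin 3) ℝ)
    (k₁ k₂ ε : ℝ) (t : ℝ) (x v : AttState) : Prop :=
  attitudeEqs J Γ (pdLaw k₁ k₂ ε x) t x v

/-- The attitude states proper: `q` is a unit quaternion. -/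
def unitStates : Set AttState := {x | ‖x.1‖ = 1}

/-- The target state `(q̄, 0)` with `q̄ = (0, 0, 0, 1)`. -/
noncomputable def targetState : AttState := (!₂[0, 0, 0, 1], 0)

/-- `x` solves the (possibly implicit) differential equation `F(t, x, x') ` on the interval `I`,
with one-sided derivatives at end points that belong to `I`. -/
def IsSolOn {E : Type*} [NormedAddCommGroup E] [NormedSpace ℝ E]
    (F : ℝ → E → E → Prop) (I : Set ℝ) (x : ℝ → E) : Prop :=
  ∀ t ∈ I, ∃ v, HasDerivWithinAt x v I t ∧ F t (x t) v

/-- Local exponential stability of `e` for `F(t, x, x')` on the state space `S`, with radius `c`,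
overshoot `k` and rate `γ`: from every `ξ ∈ S` with `‖ξ - e‖ < c` and every initial time `t₀ ≥ 0`
there starts a solution that exists and stays in `S` for all `t ≥ t₀`, and every solution that
starts there obeys `‖x(t) - e‖ ≤ k ‖ξ - e‖ exp (-γ (t - t₀))` for as long as it is defined. -/
def LocExpStableWith {E : Type*} [NormedAddCommGroup E] [NormedSpace ℝ E]
    (F : ℝ → E → E → Prop) (S : Set E) (e : E) (c k γ : ℝ) : Prop :=
  ∀ t₀ : ℝ, 0 ≤ t₀ → ∀ ξ ∈ S, ‖ξ - e‖ < c →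
    (∃ x : ℝ → E, x t₀ = ξ ∧ IsSolOn F (Set.Ici t₀) x ∧ ∀ t, t₀ ≤ t → x t ∈ S) ∧
    ∀ (T : ℝ) (x : ℝ → E), x t₀ = ξ → IsSolOn F (Set.Icc t₀ T) x →
      ∀ t ∈ Set.Icc t₀ T, ‖x t - e‖ ≤ k * ‖ξ - e‖ * Real.exp (-γ * (t - t₀))

/-! Write `ω = ε z` and `a = q_v`. Near the target the closed loop is `a' = (ε/2) z`, `J z' = -ε
Γ(t) (k₁ a + k₂ z)`, up to terms of higher order in the state. On a circular orbit `‖r‖` is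
constant, so the entries of `Γ` are trigonometric polynomials, and each is its mean plus the
derivative of a bounded function (`OrbitField.exists_gammaMean`). With `G` the mean and `Γ - G =
H'`, `H` bounded, averaging is an exact substitution: the time-dependent part cancels in the
derivative of `y = J z + ε H (k₁ a + k₂ z)`, and `y' = -ε G (k₁ a + k₂ z)` up to `ε` times a small
multiple of `‖a‖ + ‖z‖` (`closedLoop.exists_averaged_eq`).

For the averaged system take `P = G⁻¹` and `V = ½⟨P y, y⟩ + k₁⟨J a, a⟩ + δ⟨J a, P y⟩`. To leading
order `y = J z`; since `P G = 1`, the mixed terms from the first two summands cancel and leave `-ε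
k₂⟨J z, z⟩`, while the cross term contributes the missing damping `-ε δ k₁⟨J a, a⟩`. For small `δ`,
`V` is comparable with `(‖a‖ + ‖z‖)²` and decays at a rate proportional to `ε`, with constants that
see `J` only through its spectral bounds (`exists_lyap_constants`).

The averaging error is absorbed by taking `ε` small, the nonlinear terms by then taking the
neighbourhood small. The neighbourhood depends on `ε`, because the gyroscopic term enters with a
factor `1/ε` (`closedLoop.exists_momentum_eq`). A Lyapunov argument on the invariant set of unit
quaternions concludes (`locExpStableWith_of_lyapunov`); global solutions come from a cut-off vector
field (`exists_curve_solution_in_ball`). -/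

/-! ### Trigonometric polynomials and their means -/

/-- Trigonometric polynomials with arbitrary real frequencies. -/
inductive IsTrigPoly : (ℝ → ℝ) → Prop
  | cos (a b : ℝ) : IsTrigPoly fun t => Real.cos (a * t + b)
  | smul (c : ℝ) {f : ℝ → ℝ} : IsTrigPoly f → IsTrigPoly fun t => c * f t
  | add {f g : ℝ → ℝ} : IsTrigPoly f → IsTrigPoly g → IsTrigPoly fun t => f t + g t

namespace IsTrigPoly

lemma const (c : ℝ) : IsTrigPoly fun _ => c := by
  simpa using (cos 0 0).smul c

lemma sin (a b : ℝ) : IsTrigPoly fun t => Real.sin (a * t + b) := by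
  have h := cos a (b - Real.pi / 2)
  convert h using 2 with t
  rw [← Real.cos_sub_pi_div_two]; ring_nf

lemma neg {f : ℝ → ℝ} (hf : IsTrigPoly f) : IsTrigPoly fun t => -f t := by
  simpa using hf.smul (-1)

lemma sub {f g : ℝ → ℝ} (hf : IsTrigPoly f) (hg : IsTrigPoly g) :
    IsTrigPoly fun t => f t - g t := by
  simpa [sub_eq_add_neg] using hf.add hg.neg

/-- The product-to-sum formula for two cosines, extended bilinearly. -/
lemma mul {f g : ℝ → ℝ} (hf : IsTrigPoly f) (hg : IsTrigPoly g) :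
    IsTrigPoly fun t => f t * g t := by
  induction hf with
  | cos a b =>
    induction hg with
    | cos c d =>
      have h := ((cos (a - c) (b - d)).add (cos (a + c) (b + d))).smul (1 / 2)
      convert h using 2 with t
      have e₁ : (a - c) * t + (b - d) = (a * t + b) - (c * t + d) := by ring
      have e₂ : (a + c) * t + (b + d) = (a * t + b) + (c * t + d) := by ring
      rw [e₁, e₂, Real.cos_sub (a * t + b), Real.cos_add (a * t + b)]; ring
    | smul c _ ih =>
      convert ih.smul c using 2; ring
    | add _ _ ih₁ ih₂ =>
      convert ih₁.add ih₂ using 2; ring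
  | smul c _ ih =>
    convert ih.smul c using 2; ring
  | add _ _ ih₁ ih₂ =>
    convert ih₁.add ih₂ using 2; ring

lemma continuous {f : ℝ → ℝ} (hf : IsTrigPoly f) : Continuous f := by
  induction hf with
  | cos a b => fun_prop
  | smul c _ ih => fun_prop
  | add _ _ ih₁ ih₂ => fun_prop

lemma exists_abs_le {f : ℝ → ℝ} (hf : IsTrigPoly f) : ∃ C, ∀ t, |f t| ≤ C := by
  induction hf with
  | cos a b => exact ⟨1, fun t => Real.abs_cos_le_one _⟩
  | smul c _ ih =>
    obtain ⟨C, hC⟩ := ih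
    exact ⟨|c| * C, fun t => by rw [abs_mul]; gcongr; exact hC t⟩
  | add _ _ ih₁ ih₂ =>
    obtain ⟨C, hC⟩ := ih₁
    obtain ⟨D, hD⟩ := ih₂
    exact ⟨C + D, fun t => (abs_add_le _ _).trans (add_le_add (hC t) (hD t))⟩

/-- Up to a constant, a trigonometric polynomial has a bounded primitive. -/
lemma exists_bounded_primitive {f : ℝ → ℝ} (hf : IsTrigPoly f) :
    ∃ (m C : ℝ) (F : ℝ → ℝ), (∀ t, HasDerivAt F (f t - m) t) ∧ ∀ t, |F t| ≤ C := by
  induction hf with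
  | cos a b =>
    by_cases ha : a = 0
    · refine ⟨Real.cos b, 0, fun _ => 0, fun t => ?_, by simp⟩
      simpa [ha] using hasDerivAt_const t (0 : ℝ)
    · refine ⟨0, |1 / a|, fun t => (1 / a) * Real.sin (a * t + b), fun t => ?_, fun t => ?_⟩
      · have h : HasDerivAt (fun t : ℝ => a * t + b) a t := by
          simpa using ((hasDerivAt_id t).const_mul a).add_const b
        refine (h.sin.const_mul (1 / a)).congr_deriv ?_
        field_simp; ring
      · rw [abs_mul]
        exact mul_le_of_le_one_right (abs_nonneg _) (Real.abs_sin_le_one _)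
  | smul c _ ih =>
    obtain ⟨m, C, F, hF, hC⟩ := ih
    refine ⟨c * m, |c| * C, fun t => c * F t, fun t => ?_, fun t => ?_⟩
    · exact ((hF t).const_mul c).congr_deriv (by ring)
    · rw [abs_mul]; gcongr; exact hC t
  | add _ _ ih₁ ih₂ =>
    obtain ⟨m, C, F, hF, hC⟩ := ih₁
    obtain ⟨m', C', F', hF', hC'⟩ := ih₂
    refine ⟨m + m', C + C', fun t => F t + F' t, fun t => ?_, fun t => ?_⟩
    · exact ((hF t).add (hF' t)).congr_deriv (by ring)
    · exact (abs_add_le _ _).trans (add_le_add (hC t) (hC' t))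

end IsTrigPoly

/-- A continuous function which is a constant plus the derivative of a bounded function has that
constant as its mean. -/
lemma tendsto_mean_of_bounded_primitive {f F : ℝ → ℝ} {m C : ℝ} (hf : Continuous f)
    (hF : ∀ t, HasDerivAt F (f t - m) t) (hC : ∀ t, |F t| ≤ C) :
    Tendsto (fun T : ℝ => (1 / T) * ∫ τ in (0 : ℝ)..T, f τ) atTop (𝓝 m) := by
  have hint : ∀ T : ℝ, ∫ τ in (0 : ℝ)..T, f τ = (F T - F 0) + m * T := by
    intro T
    have h := intervalIntegral.integral_eq_sub_of_hasDerivAt (a := 0) (b := T)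
      (f := fun t => F t + m * t) (f' := f) (fun t _ => by
        exact ((hF t).add ((hasDerivAt_id t).const_mul m)).congr_deriv (by simp))
      (hf.intervalIntegrable _ _)
    rw [h]; ring
  -- The mean differs from `m` by a bounded quantity divided by `T`.
  have h1 : Tendsto (fun T : ℝ => T⁻¹ * (F T - F 0)) atTop (𝓝 0) := by
    refine Tendsto.zero_mul_isBoundedUnder_le tendsto_inv_atTop_zero ?_
    refine isBoundedUnder_of ⟨C + C, fun T => ?_⟩
    exact (abs_sub _ _).trans (add_le_add (hC T) (hC 0))
  have h2 : Tendsto (fun T : ℝ => T⁻¹ * (F T - F 0) + m) atTop (𝓝 m) := by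
    simpa using h1.add_const m
  refine h2.congr' ?_
  filter_upwards [eventually_gt_atTop 0] with T hT
  rw [hint]; field_simp

/-! ### The dipole field along a circular orbit -/

namespace OrbitField

/-- Rotations preserve length. The constancy of this norm turns the divisions in `positionDir` and
`field` into constant factors, so that the field remains a trigonometric polynomial. -/
lemma norm_position (p : OrbitField) (hR : 0 < p.radius) (t : ℝ) : ‖p.position t‖ = p.radius := by
  rw [EuclideanSpace.norm_eq, Real.sqrt_eq_iff_eq_sq (by positivity) hR.le]
  simp only [position, xp, yp, Fin.sum_univ_three, Real.norm_eq_abs, sq_abs]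
  simp
  have h1 := Real.sin_sq_add_cos_sq p.node
  have h2 := Real.sin_sq_add_cos_sq p.incl
  have h3 := Real.sin_sq_add_cos_sq (p.orbRate * t + p.phase)
  generalize Real.sin p.node = s1 at *
  generalize Real.cos p.node = c1 at *
  generalize Real.sin p.incl = s2 at *
  generalize Real.cos p.incl = c2 at *
  generalize Real.sin (p.orbRate * t + p.phase) = s3 at *
  generalize Real.cos (p.orbRate * t + p.phase) = c3 at *
  linear_combination p.radius ^ 2 * ((c3 ^ 2 + c2 ^ 2 * s3 ^ 2) * h1 + s3 ^ 2 * h2 + h3)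

lemma isTrigPoly_dipoleDir (p : OrbitField) (i : Fin 3) : IsTrigPoly fun t => p.dipoleDir t i := by
  fin_cases i
  · exact (IsTrigPoly.cos _ _).smul _
  · exact (IsTrigPoly.sin _ _).smul _
  · exact .const _

lemma isTrigPoly_position (p : OrbitField) (i : Fin 3) : IsTrigPoly fun t => p.position t i := by
  have hx : IsTrigPoly p.xp := (IsTrigPoly.cos _ _).smul _
  have hy : IsTrigPoly p.yp := (IsTrigPoly.sin _ _).smul _
  fin_cases i
  · exact (hx.smul _).sub (hy.smul _)
  · exact (hx.smul _).add (hy.smul _)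
  · exact hy.smul _

lemma isTrigPoly_field (p : OrbitField) (hR : 0 < p.radius) (i : Fin 3) :
    IsTrigPoly fun t => p.field t i := by
  have hd : ∀ i, IsTrigPoly fun t => p.positionDir t i := fun i => by
    simpa [positionDir, p.norm_position hR] using (p.isTrigPoly_position i).smul p.radius⁻¹
  have hin : IsTrigPoly fun t => inner ℝ (p.dipoleDir t) (p.positionDir t) := by
    simp only [PiLp.inner_apply, Fin.sum_univ_three]
    have := fun i => (hd i).mul (p.isTrigPoly_dipoleDir i)
    exact ((this 0).add (this 1)).add (this 2)
  simpa [field, p.norm_position hR] using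
    (((hin.smul 3).mul (hd i)).sub (p.isTrigPoly_dipoleDir i)).smul (p.dipole / p.radius ^ 3)

lemma isTrigPoly_gamma (p : OrbitField) (hR : 0 < p.radius) (i j : Fin 3) :
    IsTrigPoly fun t => p.gamma t i j := by
  have hs : ∀ i j, IsTrigPoly fun t => skewMat (p.field t) i j := by
    intro i j
    have := p.isTrigPoly_field hR
    have h' := fun i => (this i).neg
    fin_cases i <;> fin_cases j <;> first | exact this _ | exact h' _ | exact .const 0
  simp only [gamma, Matrix.mul_apply, Matrix.transpose_apply, Fin.sum_univ_three]
  have := fun k => (hs i k).mul (hs j k)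
  exact ((this 0).add (this 1)).add (this 2)

/-- The mean of `Γⁱ` exists, and `Γⁱ` minus its mean has a bounded primitive. -/
lemma exists_gammaMean (p : OrbitField) (hR : 0 < p.radius) :
    ∃ Γav : Matrix (Fin 3) (Fin 3) ℝ, Tendsto p.gammaMean atTop (𝓝 Γav) ∧
      ∃ (C : ℝ) (H : ℝ → Matrix (Fin 3) (Fin 3) ℝ),
        (∀ t i j, HasDerivAt (fun s => H s i j) (p.gamma t i j - Γav i j) t) ∧
        (∀ t i j, |H t i j| ≤ C) ∧ ∀ t i j, |p.gamma t i j| ≤ C := by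
  choose m C F hF hC using fun i j => (p.isTrigPoly_gamma hR i j).exists_bounded_primitive
  choose D hD using fun i j => (p.isTrigPoly_gamma hR i j).exists_abs_le
  -- A single constant dominating the bounds for all entries and all primitives.
  refine ⟨Matrix.of m, ?_, ∑ i, ∑ j, (|C i j| + |D i j|), fun t => Matrix.of fun i j => F i j t,
    fun t i j => hF i j t, fun t i j => ?_, fun t i j => ?_⟩
  · refine tendsto_pi_nhds.2 fun i => tendsto_pi_nhds.2 fun j => ?_
    exact tendsto_mean_of_bounded_primitive (p.isTrigPoly_gamma hR i j).continuous (hF i j)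
      (hC i j)
  all_goals
    have h1 : |C i j| + |D i j| ≤ ∑ j, (|C i j| + |D i j|) :=
      Finset.single_le_sum (f := fun j => |C i j| + |D i j|) (fun _ _ => by positivity)
        (Finset.mem_univ j)
    have h2 : ∑ j, (|C i j| + |D i j|) ≤ ∑ i, ∑ j, (|C i j| + |D i j|) :=
      Finset.single_le_sum (f := fun i => ∑ j, (|C i j| + |D i j|)) (fun _ _ => by positivity)
        (Finset.mem_univ i)
    refine le_trans ?_ (h1.trans h2)
  · exact (hC i j t).trans ((le_abs_self _).trans (by linarith [abs_nonneg (D i j)]))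
  · exact (hD i j t).trans ((le_abs_self _).trans (by linarith [abs_nonneg (C i j)]))

end OrbitField

/-! ### The Lyapunov function of the averaged system -/

/-- Young's inequality `b x y ≤ p/4 x² + q y²` when `b² ≤ p q`. -/
lemma mul_le_weighted_sq {p q b x y : ℝ} (hp : 0 < p) (hb : b ^ 2 ≤ p * q) :
    b * (x * y) ≤ p / 4 * x ^ 2 + q * y ^ 2 := by
  -- After multiplication by `p` the difference is `(p/2 x - b y)² + (p q - b²) y²`.
  have e : 0 ≤ p * (p / 4 * x ^ 2 + q * y ^ 2 - b * (x * y)) := by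
    have h1 := mul_le_mul_of_nonneg_right hb (sq_nonneg y)
    have h2 := sq_nonneg (p / 2 * x - b * y)
    linarith
  linarith [nonneg_of_mul_nonneg_right e hp]

section Lyapunov

variable {E : Type*} [NormedAddCommGroup E] [InnerProductSpace ℝ E]

/-- A symmetric operator whose quadratic form is at least `m ‖x‖²` and whose norm is at most `M`. -/
structure SymmBounded (m M : ℝ) (L : E →L[ℝ] E) : Prop where
  symm : ∀ x y, inner ℝ (L x) y = inner ℝ x (L y)
  lower : ∀ x, m * ‖x‖ ^ 2 ≤ inner ℝ (L x) x
  upper : ∀ x, ‖L x‖ ≤ M * ‖x‖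

lemma SymmBounded.le_norm {m M : ℝ} {L : E →L[ℝ] E} (h : SymmBounded m M L) (x : E) :
    m * ‖x‖ ≤ ‖L x‖ := by
  rcases eq_or_ne x 0 with rfl | hx
  · simp
  have h1 := (h.lower x).trans (real_inner_le_norm _ _)
  have hx : 0 < ‖x‖ := norm_pos_iff.2 hx
  nlinarith

/-- The Lyapunov function of the averaged system, with cross term of weight `δ`. -/
noncomputable def lyap (J P : E →L[ℝ] E) (k₁ δ : ℝ) (a y : E) : ℝ :=
  (1 / 2) * inner ℝ (P y) y + k₁ * inner ℝ (J a) a + δ * inner ℝ (J a) (P y)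

/-- The derivative of `lyap` at `(a, y)` in the direction `(a', y')`. -/
noncomputable def lyapDeriv (J P : E →L[ℝ] E) (k₁ δ : ℝ) (a y a' y' : E) : ℝ :=
  inner ℝ (P y) y' + 2 * k₁ * inner ℝ (J a) a'
    + δ * (inner ℝ (J a') (P y) + inner ℝ (J a) (P y'))

lemma hasDerivAt_lyap {J P : E →L[ℝ] E} (hJ : ∀ x y, inner ℝ (J x) y = inner ℝ x (J y))
    (hP : ∀ x y, inner ℝ (P x) y = inner ℝ x (P y)) (k₁ δ : ℝ) {a y : ℝ → E} {a' y' : E} {t : ℝ}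
    (ha : HasDerivAt a a' t) (hy : HasDerivAt y y' t) :
    HasDerivAt (fun s => lyap J P k₁ δ (a s) (y s)) (lyapDeriv J P k₁ δ (a t) (y t) a' y') t := by
  have hJa := J.hasFDerivAt.comp_hasDerivAt t ha
  have hPy := P.hasFDerivAt.comp_hasDerivAt t hy
  refine ((((hPy.inner ℝ hy).const_mul (1 / 2)).add ((hJa.inner ℝ ha).const_mul k₁)).add
    ((hJa.inner ℝ hPy).const_mul δ)).congr_deriv ?_
  simp only [lyapDeriv, Function.comp]
  rw [hP y', hJ a' (a t), real_inner_comm _ y', real_inner_comm _ a']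
  ring

lemma abs_inner_le {x y : E} {A B : ℝ} (hx : ‖x‖ ≤ A) (hy : ‖y‖ ≤ B) : |inner ℝ x y| ≤ A * B :=
  (abs_real_inner_le_norm x y).trans
    (mul_le_mul hx hy (norm_nonneg _) ((norm_nonneg _).trans hx))

lemma inner_le_of_le {x y : E} {A B : ℝ} (hx : ‖x‖ ≤ A) (hy : ‖y‖ ≤ B) : inner ℝ x y ≤ A * B :=
  (le_abs_self _).trans (abs_inner_le hx hy)

/-- Lower bound for the Lyapunov function, when `y` is a small perturbation of `J z`. -/
lemma lyap_lower {Jmin Jmax pm pM k₁ δ M : ℝ} (hJmin : 0 < Jmin) (hJmax : 0 < Jmax)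
    (hpm : 0 < pm) (hpM : 0 < pM) (hk₁ : 0 < k₁) (hδ : 0 < δ) (hδ1 : δ ≤ 1)
    (hδ2 : δ * (Jmax ^ 2 * pM ^ 2) ≤ pm * (k₁ * Jmin / 2))
    {J P : E →L[ℝ] E} (hJ : SymmBounded Jmin Jmax J) (hP : SymmBounded pm pM P)
    {ε : ℝ} (hε : 0 < ε) (hεM : ε * M ≤ Jmin / 2) {a z h : E}
    (hh : ‖h‖ ≤ M * (‖a‖ + ‖z‖)) :
    min (pm / 4) (k₁ * Jmin / 2) / (8 * (1 + 1 / Jmin) ^ 2) * (‖a‖ + ‖z‖) ^ 2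
      ≤ lyap J P k₁ δ a (J z + ε • h) := by
  set n := ‖a‖ + ‖z‖ with hn
  have ha0 := norm_nonneg a
  have hz0 := norm_nonneg z
  have hn0 : 0 ≤ n := by linarith
  set y := J z + ε • h with hy
  have hεh : ‖ε • h‖ ≤ ε * (M * n) := by
    rw [norm_smul, Real.norm_of_nonneg hε.le]; gcongr
  have hy0 := norm_nonneg y
  have hPy : ‖P y‖ ≤ pM * ‖y‖ := hP.upper y
  have hJa : ‖J a‖ ≤ Jmax * ‖a‖ := hJ.upper a
  have hcross : |inner ℝ (J a) (P y)| ≤ Jmax * ‖a‖ * (pM * ‖y‖) := abs_inner_le hJa hPy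
  have hcross' := abs_le.1 hcross
  have h1 := hP.lower y
  have h2 := hJ.lower a
  have hzz : Jmin * ‖z‖ ≤ ‖y‖ + ε * M * n := by
    have e : J z = y - ε • h := by simp [hy]
    have := hJ.le_norm z
    rw [e] at this
    have := norm_sub_le y (ε • h)
    linarith
  -- Since `ε M ≤ Jmin / 2`, solving for `‖z‖` costs at most `n / 2`, which is absorbed on the left.
  have hnn : n ≤ 2 * (1 + 1 / Jmin) * (‖a‖ + ‖y‖) := by
    have h3 : ε * M * n ≤ Jmin / 2 * n := by gcongr
    have h4 : ‖z‖ ≤ ‖y‖ / Jmin + n / 2 := by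
      rw [← sub_nonneg]
      have : 0 ≤ (‖y‖ + Jmin / 2 * n - Jmin * ‖z‖) / Jmin :=
        div_nonneg (by linarith) hJmin.le
      convert this using 1; field_simp
    have h5 : n ≤ 2 * ‖a‖ + 2 * (‖y‖ / Jmin) := by linarith
    have h6 : 2 * (1 + 1 / Jmin) * (‖a‖ + ‖y‖)
        = 2 * ‖a‖ + 2 * (‖y‖ / Jmin) + 2 * ‖y‖ + 2 * (‖a‖ / Jmin) := by field_simp; ring
    rw [h6]
    have : 0 ≤ ‖a‖ / Jmin := by positivity
    linarith
  have h7 : pm / 4 * ‖y‖ ^ 2 + k₁ * Jmin / 2 * ‖a‖ ^ 2 ≤ lyap J P k₁ δ a y := by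
    have h8 : δ * (Jmax * ‖a‖ * (pM * ‖y‖)) ≤ pm / 4 * ‖y‖ ^ 2 + k₁ * Jmin / 2 * ‖a‖ ^ 2 := by
      -- As `δ ≤ 1`, a smallness condition linear in `δ` suffices for the quadratic one in Young's
      -- inequality.
      have h9 : (δ * (Jmax * pM)) ^ 2 ≤ pm * (k₁ * Jmin / 2) := by
        refine le_trans ?_ hδ2
        calc (δ * (Jmax * pM)) ^ 2 = δ * (δ * (Jmax ^ 2 * pM ^ 2)) := by ring
          _ ≤ 1 * (δ * (Jmax ^ 2 * pM ^ 2)) := by gcongr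
          _ = _ := one_mul _
      have h10 := mul_le_weighted_sq (x := ‖y‖) (y := ‖a‖) hpm h9
      linarith
    have h9 : -(δ * (Jmax * ‖a‖ * (pM * ‖y‖))) ≤ δ * inner ℝ (J a) (P y) := by
      have := mul_le_mul_of_nonneg_left hcross'.1 hδ.le
      linarith
    have h10 := mul_le_mul_of_nonneg_left h2 hk₁.le
    unfold lyap
    linarith
  refine le_trans ?_ h7
  set μ := min (pm / 4) (k₁ * Jmin / 2) with hμ
  have hμ0 : 0 < μ := lt_min (by positivity) (by positivity)
  have h8 : μ / 2 * (‖a‖ + ‖y‖) ^ 2 ≤ pm / 4 * ‖y‖ ^ 2 + k₁ * Jmin / 2 * ‖a‖ ^ 2 := by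
    have e1 : μ * ‖y‖ ^ 2 ≤ pm / 4 * ‖y‖ ^ 2 := by gcongr; exact min_le_left _ _
    have e2 : μ * ‖a‖ ^ 2 ≤ k₁ * Jmin / 2 * ‖a‖ ^ 2 := by gcongr; exact min_le_right _ _
    have e3 := mul_nonneg hμ0.le (sq_nonneg (‖a‖ - ‖y‖))
    linarith
  refine le_trans ?_ h8
  calc μ / (8 * (1 + 1 / Jmin) ^ 2) * n ^ 2
      ≤ μ / (8 * (1 + 1 / Jmin) ^ 2) * (2 * (1 + 1 / Jmin) * (‖a‖ + ‖y‖)) ^ 2 := by gcongr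
    _ = μ / 2 * (‖a‖ + ‖y‖) ^ 2 := by field_simp; ring

/-- Upper bound for the Lyapunov function, when `y` is a small perturbation of `J z`. -/
lemma lyap_upper {Jmin Jmax pm pM k₁ δ M : ℝ} (hJmax : 0 < Jmax)
    (hpM : 0 < pM) (hk₁ : 0 < k₁) (hδ : 0 < δ) (hδ1 : δ ≤ 1) (hM : 0 ≤ M)
    {J P : E →L[ℝ] E} (hJ : SymmBounded Jmin Jmax J) (hP : SymmBounded pm pM P)
    {ε : ℝ} (hε : 0 < ε) (hε1 : ε ≤ 1) {a z h : E}
    (hh : ‖h‖ ≤ M * (‖a‖ + ‖z‖)) :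
    lyap J P k₁ δ a (J z + ε • h)
      ≤ (pM * (Jmax + M) ^ 2 + k₁ * Jmax + Jmax * pM * (Jmax + M)) * (‖a‖ + ‖z‖) ^ 2 := by
  set n := ‖a‖ + ‖z‖ with hn
  have ha0 := norm_nonneg a
  have hz0 := norm_nonneg z
  have han : ‖a‖ ≤ n := by linarith
  have hzn : ‖z‖ ≤ n := by linarith
  have hn0 : 0 ≤ n := by linarith
  set y := J z + ε • h with hy
  have hεh : ‖ε • h‖ ≤ ε * (M * n) := by
    rw [norm_smul, Real.norm_of_nonneg hε.le]; gcongr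
  have hεh' : ‖ε • h‖ ≤ M * n := hεh.trans (mul_le_of_le_one_left (by positivity) hε1)
  have hy1 : ‖y‖ ≤ (Jmax + M) * n := by
    have := norm_add_le (J z) (ε • h)
    have := hJ.upper z
    have : Jmax * ‖z‖ ≤ Jmax * n := by gcongr
    linarith
  have hy0 := norm_nonneg y
  have hPy : ‖P y‖ ≤ pM * ‖y‖ := hP.upper y
  have hJa : ‖J a‖ ≤ Jmax * ‖a‖ := hJ.upper a
  have hcross : |inner ℝ (J a) (P y)| ≤ Jmax * ‖a‖ * (pM * ‖y‖) := abs_inner_le hJa hPy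
  have hcross' := abs_le.1 hcross
  have h1 : inner ℝ (P y) y ≤ pM * (Jmax + M) ^ 2 * n ^ 2 := by
    refine (inner_le_of_le hPy le_rfl).trans ?_
    calc pM * ‖y‖ * ‖y‖ ≤ pM * ((Jmax + M) * n) * ((Jmax + M) * n) := by gcongr
      _ = _ := by ring
  have h2 : inner ℝ (J a) a ≤ Jmax * n ^ 2 := by
    refine (inner_le_of_le hJa le_rfl).trans ?_
    calc Jmax * ‖a‖ * ‖a‖ ≤ Jmax * n * n := by gcongr
      _ = _ := by ring
  have h3 : δ * inner ℝ (J a) (P y) ≤ Jmax * pM * (Jmax + M) * n ^ 2 := by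
    calc δ * inner ℝ (J a) (P y) ≤ 1 * (Jmax * ‖a‖ * (pM * ‖y‖)) := by
          refine (mul_le_mul_of_nonneg_left hcross'.2 hδ.le).trans ?_
          gcongr
      _ ≤ 1 * (Jmax * n * (pM * ((Jmax + M) * n))) := by gcongr
      _ = _ := by ring
  have h4 : 0 ≤ pM * (Jmax + M) ^ 2 * n ^ 2 := by positivity
  unfold lyap
  have h5 := mul_le_mul_of_nonneg_left h2 hk₁.le
  linarith

/-- The decay of the quadratic form of the averaged linear system. -/
lemma lyap_main_le {Jmin Jmax pM k₁ k₂ δ : ℝ} (hJmin : 0 < Jmin)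
    (hk₁ : 0 < k₁) (hk₂ : 0 < k₂) (hδ : 0 < δ) (hpM : 0 < pM)
    (hδ2 : δ * (pM * Jmax ^ 2 / 2 + (k₂ * Jmax) ^ 2 / (2 * k₁ * Jmin)) ≤ k₂ * Jmin / 2)
    {J P : E →L[ℝ] E} (hJ : SymmBounded Jmin Jmax J) (hP : ∀ x, ‖P x‖ ≤ pM * ‖x‖) (a z : E) :
    -k₂ * inner ℝ (J z) z - δ * k₁ * inner ℝ (J a) a
      + δ / 2 * inner ℝ (J z) (P (J z)) - δ * k₂ * inner ℝ (J a) z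
      ≤ -(min (k₂ * Jmin / 2) (δ * k₁ * Jmin / 2) / 2 * (‖a‖ + ‖z‖) ^ 2) := by
  have hJz : ‖J z‖ ≤ Jmax * ‖z‖ := hJ.upper z
  have hJa : ‖J a‖ ≤ Jmax * ‖a‖ := hJ.upper a
  have bP : ∀ {x : E} {C : ℝ}, ‖x‖ ≤ C → ‖P x‖ ≤ pM * C := fun {x C} hx =>
    (hP x).trans (by gcongr)
  set μ := min (k₂ * Jmin / 2) (δ * k₁ * Jmin / 2) with hμ
  have hμ0 : 0 < μ := lt_min (by positivity) (by positivity)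
  have m1 := mul_le_mul_of_nonneg_left (hJ.lower z) hk₂.le
  have m2 := mul_le_mul_of_nonneg_left (hJ.lower a) (mul_pos hδ hk₁).le
  have m3 : δ / 2 * inner ℝ (J z) (P (J z)) ≤ δ * (pM * Jmax ^ 2 / 2) * ‖z‖ ^ 2 := by
    have := mul_le_mul_of_nonneg_left (inner_le_of_le hJz (bP hJz)) (half_pos hδ).le
    refine this.trans (le_of_eq ?_); ring
  -- Young's inequality, spending half of the damping `δ k₁ Jmin ‖a‖²`; the `‖z‖²` part carries a
  -- factor `δ` and goes against the damping of `z`.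
  have m4 : -(δ * k₂ * inner ℝ (J a) z) ≤ δ * (k₁ * Jmin / 2 * ‖a‖ ^ 2
      + (k₂ * Jmax) ^ 2 / (2 * k₁ * Jmin) * ‖z‖ ^ 2) := by
    have h1 := (abs_le.1 (abs_inner_le hJa (le_refl ‖z‖))).1
    have h2 : k₂ * (Jmax * ‖a‖ * ‖z‖) ≤ k₁ * Jmin / 2 * ‖a‖ ^ 2
        + (k₂ * Jmax) ^ 2 / (2 * k₁ * Jmin) * ‖z‖ ^ 2 := by
      rw [← sub_nonneg]
      have : 0 ≤ (k₁ * Jmin * ‖a‖ - k₂ * Jmax * ‖z‖) ^ 2 / (2 * k₁ * Jmin) := by positivity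
      convert this using 1; field_simp; ring
    have h3 := mul_le_mul_of_nonneg_left h2 hδ.le
    have h4 := mul_le_mul_of_nonneg_left h1 (mul_pos hδ hk₂).le
    linarith
  have m5 := mul_le_mul_of_nonneg_right hδ2 (sq_nonneg ‖z‖)
  have e1 : μ * ‖z‖ ^ 2 ≤ k₂ * Jmin / 2 * ‖z‖ ^ 2 := by gcongr; exact min_le_left _ _
  have e2 : μ * ‖a‖ ^ 2 ≤ δ * k₁ * Jmin / 2 * ‖a‖ ^ 2 := by gcongr; exact min_le_right _ _
  have e3 : μ / 2 * (‖a‖ + ‖z‖) ^ 2 ≤ μ * ‖z‖ ^ 2 + μ * ‖a‖ ^ 2 := by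
    have := mul_nonneg hμ0.le (sq_nonneg (‖a‖ - ‖z‖))
    linarith
  linarith

/-- Decay of the Lyapunov function along perturbations of the averaged linear system. -/
lemma lyapDeriv_le {Jmin Jmax pM gM k₁ k₂ δ M : ℝ} (hJmin : 0 < Jmin) (hJmax : 0 < Jmax)
    (hpM : 0 < pM) (hgM : 0 < gM) (hk₁ : 0 < k₁) (hk₂ : 0 < k₂) (hδ : 0 < δ) (hδ1 : δ ≤ 1)
    (hM : 0 ≤ M)
    (hδ2 : δ * (pM * Jmax ^ 2 / 2 + (k₂ * Jmax) ^ 2 / (2 * k₁ * Jmin)) ≤ k₂ * Jmin / 2)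
    {J P G : E →L[ℝ] E} (hJ : SymmBounded Jmin Jmax J)
    (hPs : ∀ x y, inner ℝ (P x) y = inner ℝ x (P y)) (hP : ∀ x, ‖P x‖ ≤ pM * ‖x‖)
    (hG : ∀ x, ‖G x‖ ≤ gM * ‖x‖) (hPG : ∀ x, P (G x) = x)
    {ε η : ℝ} (hε : 0 < ε) (hε1 : ε ≤ 1) (hη : 0 ≤ η) (hη1 : η ≤ 1) {a z h r₁ r₂ : E}
    (hh : ‖h‖ ≤ M * (‖a‖ + ‖z‖)) (hr₁ : ‖r₁‖ ≤ η * (‖a‖ + ‖z‖)) (hr₂ : ‖r₂‖ ≤ η * (‖a‖ + ‖z‖)) :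
    lyapDeriv J P k₁ δ a (J z + ε • h) ((ε / 2) • z + ε • r₁)
        (-(ε • G (k₁ • a + k₂ • z)) + ε • r₂)
      ≤ -ε * (min (k₂ * Jmin / 2) (δ * k₁ * Jmin / 2) / 2
          - (ε + η) * (pM * Jmax + pM * M * (gM * (k₁ + k₂) + 1) + 2 * k₁ * Jmax + Jmax * pM * M
            + Jmax * pM * (Jmax + M) + Jmax * pM)) * (‖a‖ + ‖z‖) ^ 2 := by
  set n := ‖a‖ + ‖z‖ with hn
  have ha0 := norm_nonneg a
  have hz0 := norm_nonneg z
  have han : ‖a‖ ≤ n := by linarith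
  have hzn : ‖z‖ ≤ n := by linarith
  have hn0 : 0 ≤ n := by linarith
  set w := k₁ • a + k₂ • z with hw
  have hwn : ‖w‖ ≤ (k₁ + k₂) * n := by
    refine (norm_add_le _ _).trans ?_
    rw [norm_smul, norm_smul, Real.norm_of_nonneg hk₁.le, Real.norm_of_nonneg hk₂.le, add_mul]
    gcongr
  have e0 : ∀ x y, inner ℝ (P x) (G y) = inner ℝ x y := fun x y => by rw [hPs, hPG]
  have expand : lyapDeriv J P k₁ δ a (J z + ε • h) ((ε / 2) • z + ε • r₁) (-(ε • G w) + ε • r₂)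
      = ε * ((-k₂ * inner ℝ (J z) z - δ * k₁ * inner ℝ (J a) a
            + δ / 2 * inner ℝ (J z) (P (J z)) - δ * k₂ * inner ℝ (J a) z)
          + (inner ℝ (P (J z)) r₂ + ε * inner ℝ (P h) (-G w + r₂)
            + 2 * k₁ * inner ℝ (J a) r₁ + δ / 2 * ε * inner ℝ (J z) (P h)
            + δ * inner ℝ (J r₁) (P (J z + ε • h)) + δ * inner ℝ (J a) (P r₂))) := by
    -- This symmetry cancels `-ε k₁⟨J z, a⟩`, from `½⟨P y, y⟩`, against `ε k₁⟨J a, z⟩`, from `k₁⟨J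
    -- a, a⟩`. The weight is `k₁` rather than `k₁ / 2` because of the factor `1/2` in the
    -- kinematics.
    have e1 : inner ℝ (J z) a = inner ℝ (J a) z := by rw [hJ.symm, real_inner_comm]
    simp only [lyapDeriv, map_add, map_smul, map_neg, inner_add_left, inner_add_right,
      inner_smul_left, inner_smul_right, inner_neg_right, e0, hPG, conj_trivial]
    simp only [hw, inner_add_right, inner_smul_right, e1]
    ring
  rw [expand]
  have hJz : ‖J z‖ ≤ Jmax * ‖z‖ := hJ.upper z
  have hJa : ‖J a‖ ≤ Jmax * ‖a‖ := hJ.upper a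
  have hJzn : ‖J z‖ ≤ Jmax * n := hJz.trans (by gcongr)
  have hJan : ‖J a‖ ≤ Jmax * n := hJa.trans (by gcongr)
  have bP : ∀ {x : E} {C : ℝ}, ‖x‖ ≤ C → ‖P x‖ ≤ pM * C := fun {x C} hx =>
    (hP x).trans (by gcongr)
  have main := lyap_main_le hJmin hk₁ hk₂ hδ hpM hδ2 hJ hP a z
  -- Every remaining term contains `ε` or one of `r₁`, `r₂`, hence a factor `ε` or `η`.
  have err : inner ℝ (P (J z)) r₂ + ε * inner ℝ (P h) (-G w + r₂)
      + 2 * k₁ * inner ℝ (J a) r₁ + δ / 2 * ε * inner ℝ (J z) (P h)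
      + δ * inner ℝ (J r₁) (P (J z + ε • h)) + δ * inner ℝ (J a) (P r₂)
      ≤ (ε + η) * (pM * Jmax + pM * M * (gM * (k₁ + k₂) + 1) + 2 * k₁ * Jmax + Jmax * pM * M
            + Jmax * pM * (Jmax + M) + Jmax * pM) * n ^ 2 := by
    have b1 : inner ℝ (P (J z)) r₂ ≤ (ε + η) * (pM * Jmax) * n ^ 2 := by
      refine (inner_le_of_le (bP hJzn) hr₂).trans ?_
      have : 0 ≤ ε * (pM * Jmax) * n ^ 2 := by positivity
      linarith
    have b2 : ε * inner ℝ (P h) (-G w + r₂) ≤ (ε + η) * (pM * M * (gM * (k₁ + k₂) + 1)) * n ^ 2 := by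
      have h1 : ‖-G w + r₂‖ ≤ (gM * (k₁ + k₂) + 1) * n := by
        refine (norm_add_le _ _).trans ?_
        rw [norm_neg]
        have h2 : ‖G w‖ ≤ gM * ((k₁ + k₂) * n) := (hG w).trans (by gcongr)
        have h3 : ‖r₂‖ ≤ 1 * n := hr₂.trans (by gcongr)
        linarith
      have h2 := mul_le_mul_of_nonneg_left (inner_le_of_le (bP hh) h1) hε.le
      have : 0 ≤ η * (pM * M * (gM * (k₁ + k₂) + 1)) * n ^ 2 := by positivity
      linarith
    have b3 : 2 * k₁ * inner ℝ (J a) r₁ ≤ (ε + η) * (2 * k₁ * Jmax) * n ^ 2 := by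
      have h2 := mul_le_mul_of_nonneg_left (inner_le_of_le hJan hr₁) (mul_pos two_pos hk₁).le
      have : 0 ≤ ε * (2 * k₁ * Jmax) * n ^ 2 := by positivity
      linarith
    have b4 : δ / 2 * ε * inner ℝ (J z) (P h) ≤ (ε + η) * (Jmax * pM * M) * n ^ 2 := by
      calc δ / 2 * ε * inner ℝ (J z) (P h) ≤ δ / 2 * ε * (Jmax * n * (pM * (M * n))) := by
            gcongr; exact inner_le_of_le hJzn (bP hh)
        _ ≤ 1 * (ε + η) * (Jmax * n * (pM * (M * n))) := by gcongr <;> linarith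
        _ = _ := by ring
    have b5 : δ * inner ℝ (J r₁) (P (J z + ε • h))
        ≤ (ε + η) * (Jmax * pM * (Jmax + M)) * n ^ 2 := by
      have h1 : ‖J z + ε • h‖ ≤ (Jmax + M) * n := by
        refine (norm_add_le _ _).trans ?_
        rw [norm_smul, Real.norm_of_nonneg hε.le, add_mul]
        have : ε * ‖h‖ ≤ 1 * (M * n) := by gcongr
        linarith
      have h2 : ‖J r₁‖ ≤ Jmax * (η * n) := (hJ.upper r₁).trans (by gcongr)
      calc δ * inner ℝ (J r₁) (P (J z + ε • h))
          ≤ δ * (Jmax * (η * n) * (pM * ((Jmax + M) * n))) := by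
            gcongr; exact inner_le_of_le h2 (bP h1)
        _ ≤ 1 * (Jmax * ((ε + η) * n) * (pM * ((Jmax + M) * n))) := by gcongr; linarith
        _ = _ := by ring
    have b6 : δ * inner ℝ (J a) (P r₂) ≤ (ε + η) * (Jmax * pM) * n ^ 2 := by
      calc δ * inner ℝ (J a) (P r₂) ≤ δ * (Jmax * n * (pM * (η * n))) := by
            gcongr; exact inner_le_of_le hJan (bP hr₂)
        _ ≤ 1 * (Jmax * n * (pM * ((ε + η) * n))) := by gcongr; linarith
        _ = _ := by ring
    linarith
  have := mul_le_mul_of_nonneg_left (add_le_add main err) hε.le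
  linarith

/-- Constants for the Lyapunov function, uniform in `J` and in the perturbations. -/
lemma exists_lyap_constants {Jmin Jmax pm pM gM k₁ k₂ M : ℝ} (hJmin : 0 < Jmin)
    (hJmax : 0 < Jmax) (hpm : 0 < pm) (hpM : 0 < pM) (hgM : 0 < gM) (hk₁ : 0 < k₁) (hk₂ : 0 < k₂)
    (hM : 0 ≤ M) {P G : E →L[ℝ] E} (hP : SymmBounded pm pM P) (hG : ∀ x, ‖G x‖ ≤ gM * ‖x‖)
    (hPG : ∀ x, P (G x) = x) :
    ∃ δ α β c η : ℝ, 0 < α ∧ 0 < β ∧ 0 < c ∧ 0 < η ∧ η ≤ 1 ∧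
      ∀ J : E →L[ℝ] E, SymmBounded Jmin Jmax J → ∀ ε : ℝ, 0 < ε → ε ≤ η → ∀ a z h : E,
        ‖h‖ ≤ M * (‖a‖ + ‖z‖) →
        α * (‖a‖ + ‖z‖) ^ 2 ≤ lyap J P k₁ δ a (J z + ε • h) ∧
        lyap J P k₁ δ a (J z + ε • h) ≤ β * (‖a‖ + ‖z‖) ^ 2 ∧
        ∀ r₁ r₂ : E, ‖r₁‖ ≤ η * (‖a‖ + ‖z‖) → ‖r₂‖ ≤ η * (‖a‖ + ‖z‖) →
          lyapDeriv J P k₁ δ a (J z + ε • h) ((ε / 2) • z + ε • r₁)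
            (-(ε • G (k₁ • a + k₂ • z)) + ε • r₂) ≤ -(ε * c) * (‖a‖ + ‖z‖) ^ 2 := by
  obtain ⟨A, hA⟩ : ∃ A, A = Jmax ^ 2 * pM ^ 2 := ⟨_, rfl⟩
  obtain ⟨B, hB⟩ : ∃ B, B = pM * Jmax ^ 2 / 2 + (k₂ * Jmax) ^ 2 / (2 * k₁ * Jmin) := ⟨_, rfl⟩
  have hA0 : 0 < A := by rw [hA]; positivity
  have hB0 : 0 < B := by rw [hB]; positivity
  -- The bound with `A` makes `lyap` positive definite, the one with `B` makes its derivative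
  -- negative definite. Neither involves `J` or `ε`.
  obtain ⟨δ, hδ, hδ1, hδA, hδB⟩ : ∃ δ : ℝ, 0 < δ ∧ δ ≤ 1 ∧ δ * A ≤ pm * (k₁ * Jmin / 2) ∧
      δ * B ≤ k₂ * Jmin / 2 := by
    refine ⟨min 1 (min (pm * (k₁ * Jmin / 2) / A) (k₂ * Jmin / 2 / B)),
      lt_min one_pos (lt_min (by positivity) (by positivity)), min_le_left _ _, ?_, ?_⟩
    · rw [← le_div_iff₀ hA0]; exact (min_le_right _ _).trans (min_le_left _ _)
    · rw [← le_div_iff₀ hB0]; exact (min_le_right _ _).trans (min_le_right _ _)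
  set C := pM * Jmax + pM * M * (gM * (k₁ + k₂) + 1) + 2 * k₁ * Jmax + Jmax * pM * M
            + Jmax * pM * (Jmax + M) + Jmax * pM with hC
  have hC0 : 0 < C := by positivity
  set μ := min (k₂ * Jmin / 2) (δ * k₁ * Jmin / 2) / 2 with hμ
  have hμ0 : 0 < μ := half_pos (lt_min (by positivity) (by positivity))
  -- With `ε ≤ η` the total error `(ε + η) C` takes at most half of the decay `μ`. The second
  -- condition gives `ε M ≤ Jmin / 2`; `M + 1` avoids division by zero.
  obtain ⟨η, hη, hη1, hηC, hηM⟩ : ∃ η : ℝ, 0 < η ∧ η ≤ 1 ∧ η * (4 * C) ≤ μ ∧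
      η * (M + 1) ≤ Jmin / 2 := by
    refine ⟨min 1 (min (μ / (4 * C)) (Jmin / 2 / (M + 1))),
      lt_min one_pos (lt_min (by positivity) (by positivity)), min_le_left _ _, ?_, ?_⟩
    · rw [← le_div_iff₀ (by positivity)]; exact (min_le_right _ _).trans (min_le_left _ _)
    · rw [← le_div_iff₀ (by positivity)]; exact (min_le_right _ _).trans (min_le_right _ _)
  have hα : 0 < min (pm / 4) (k₁ * Jmin / 2) := lt_min (by positivity) (by positivity)
  refine ⟨δ, _, _, μ / 2, η, div_pos hα (by positivity : 0 < 8 * (1 + 1 / Jmin) ^ 2),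
    (by positivity : 0 < pM * (Jmax + M) ^ 2 + k₁ * Jmax + Jmax * pM * (Jmax + M)),
    half_pos hμ0, hη, hη1, fun J hJ ε hε hεη a z h hh => ?_⟩
  have hε1 := hεη.trans hη1
  have hεM : ε * M ≤ Jmin / 2 := by
    refine le_trans ?_ hηM
    gcongr; linarith
  refine ⟨lyap_lower hJmin hJmax hpm hpM hk₁ hδ hδ1 (hA ▸ hδA) hJ hP hε hεM hh,
    lyap_upper hJmax hpM hk₁ hδ hδ1 hM hJ hP hε hε1 hh, fun r₁ r₂ hr₁ hr₂ => ?_⟩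
  refine (lyapDeriv_le hJmin hJmax hpM hgM hk₁ hk₂ hδ hδ1 hM (hB ▸ hδB) hJ hP.symm hP.upper hG hPG
    hε hε1 hη.le hη1 hh hr₁ hr₂).trans ?_
  rw [← hC, ← hμ]
  have h1 : (ε + η) * C ≤ μ / 2 := by
    have : (ε + η) * C ≤ (η + η) * C := by gcongr
    linarith
  have h2 : ε * (μ / 2) * (‖a‖ + ‖z‖) ^ 2 ≤ ε * (μ - (ε + η) * C) * (‖a‖ + ‖z‖) ^ 2 := by
    gcongr; linarith
  linarith

end Lyapunov

/-! ### Global solutions of cut-off vector fields -/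

section GlobalExistence

variable {E : Type*} [NormedAddCommGroup E] [NormedSpace ℝ E]

/-- A bounded, globally Lipschitz nonautonomous vector field has a solution on `[t₀, T]`. -/
lemma exists_solution_Icc [CompleteSpace E] {g : ℝ → E → E} {K : NNReal} {L : ℝ}
    (hK : ∀ t, LipschitzWith K (g t)) (hc : ∀ x, Continuous fun t => g t x)
    (hL : ∀ t x, ‖g t x‖ ≤ L) (t₀ T : ℝ) (h : t₀ ≤ T) (ξ : E) :
    ∃ x : ℝ → E, x t₀ = ξ ∧ ∀ t ∈ Set.Icc t₀ T, HasDerivWithinAt x (g t (x t)) (Set.Icc t₀ T) t := by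
  -- The ball has radius `L (T - t₀)`, which no solution can leave by time `T`, so the interval need
  -- not be short.
  have hpl : IsPicardLindelof g (⟨t₀, Set.left_mem_Icc.2 h⟩ : Set.Icc t₀ T) ξ
      (L.toNNReal * (T - t₀).toNNReal) 0 L.toNNReal K := by
    refine ⟨fun t _ => (hK t).lipschitzOnWith, fun x _ => (hc x).continuousOn,
      fun t _ x _ => (hL t x).trans (Real.le_coe_toNNReal L), ?_⟩
    have h' : 0 ≤ T - t₀ := sub_nonneg.2 h
    simp [h']
  exact hpl.exists_eq_forall_mem_Icc_hasDerivWithinAt₀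

/-- A bounded, globally Lipschitz nonautonomous vector field has a solution on `[t₀, ∞)`. -/
lemma exists_solution_Ici [CompleteSpace E] {g : ℝ → E → E} {K : NNReal} {L : ℝ}
    (hK : ∀ t, LipschitzWith K (g t)) (hc : ∀ x, Continuous fun t => g t x)
    (hL : ∀ t x, ‖g t x‖ ≤ L) (t₀ : ℝ) (ξ : E) :
    ∃ x : ℝ → E, x t₀ = ξ ∧ ∀ t ∈ Set.Ici t₀, HasDerivWithinAt x (g t (x t)) (Set.Ici t₀) t := by
  choose X hX0 hX using fun n : ℕ =>
    exists_solution_Icc hK hc hL t₀ (t₀ + n) (by simp) ξ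
  have hright : ∀ n : ℕ, ∀ t ∈ Set.Ico t₀ (t₀ + n),
      HasDerivWithinAt (X n) (g t (X n t)) (Set.Ici t) t := fun n t ht =>
    (hX n t ⟨ht.1, ht.2.le⟩).mono_of_mem_nhdsWithin
      (mem_of_superset (Icc_mem_nhdsGE ht.2) (Set.Icc_subset_Icc_left ht.1))
  have hagree : ∀ m n : ℕ, m ≤ n → Set.EqOn (X m) (X n) (Set.Icc t₀ (t₀ + m)) := by
    intro m n hmn
    have hmn' : (t₀ + m : ℝ) ≤ t₀ + n := by gcongr
    exact ODE_solution_unique hK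
      (fun t ht => (hX m t ht).continuousWithinAt) (hright m)
      (fun t ht => ((hX n t ⟨ht.1, ht.2.trans hmn'⟩).continuousWithinAt).mono
        (Set.Icc_subset_Icc_right hmn'))
      (fun t ht => hright n t ⟨ht.1, ht.2.trans_le hmn'⟩) (by rw [hX0, hX0])
  have hval : ∀ (n : ℕ) (t : ℝ), t ∈ Set.Icc t₀ (t₀ + n) → X ⌈t - t₀⌉₊ t = X n t := by
    intro n t ht
    refine hagree _ _ (Nat.ceil_le.2 (by linarith [ht.2])) ⟨ht.1, ?_⟩
    linarith [Nat.le_ceil (t - t₀)]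
  -- The index varies with `t`, but by uniqueness (`hval`) this curve equals `X n` on all of `[t₀,
  -- t₀ + n]`.
  refine ⟨fun t => X ⌈t - t₀⌉₊ t, by simp [hX0], fun t ht => ?_⟩
  obtain ⟨n, hn⟩ := exists_nat_gt (t - t₀)
  have htn : t < t₀ + n := by linarith
  have htn' : t ∈ Set.Icc t₀ (t₀ + n) := ⟨ht, htn.le⟩
  have h1 := (hX n t htn').congr (fun s hs => hval n s hs) (hval n t htn')
  have hmem : Set.Icc t₀ (t₀ + n) ∈ 𝓝[Set.Ici t₀] t := by
    rw [← Set.Ici_inter_Iic]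
    exact inter_mem_nhdsWithin _ (Iic_mem_nhds htn)
  simpa only [hval n t htn'] using h1.mono_of_mem_nhdsWithin hmem

/-- For a `C¹` vector field which depends on time through a bounded continuous parameter, there is
a global curve which is an integral curve wherever it is in a given ball. -/
lemma exists_curve_solution_in_ball {Q : Type*} [NormedAddCommGroup Q] [NormedSpace ℝ Q]
    [FiniteDimensional ℝ Q] [FiniteDimensional ℝ E] {F : Q × E → E} (hF : ContDiff ℝ 1 F)
    {γ : ℝ → Q} (hγ : Continuous γ) {C : ℝ} (hC : ∀ t, ‖γ t‖ ≤ C) (r : ℝ) (e : E) (t₀ : ℝ)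
    (ξ : E) :
    ∃ x : ℝ → E, x t₀ = ξ ∧ ∀ t ∈ Set.Ici t₀, ∃ v, HasDerivWithinAt x v (Set.Ici t₀) t ∧
      (‖x t - e‖ < r → v = F (γ t, x t)) := by
  have : CompleteSpace E := FiniteDimensional.complete ℝ E
  have hR : 0 < 1 + |C| + |r| := by positivity
  -- The cutoff acts on parameter and state jointly: it is `1` wherever `‖γ t‖ ≤ C` and `‖x - e‖ <
  -- r`, and compact support in both variables makes the Lipschitz constant and the bound uniform in
  -- time.
  let χ : ContDiffBump ((0, e) : Q × E) := ⟨1 + |C| + |r|, 2 + |C| + |r|, hR, by linarith⟩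
  have hG : ContDiff ℝ 1 fun p => χ p • F p := χ.contDiff.smul hF
  have hsupp : HasCompactSupport fun p => χ p • F p := χ.hasCompactSupport.smul_right
  obtain ⟨K, hK⟩ := hG.lipschitzWith_of_hasCompactSupport hsupp one_ne_zero
  obtain ⟨L, hL⟩ := hsupp.exists_bound_of_continuous hG.continuous
  obtain ⟨x, hx0, hx⟩ := exists_solution_Ici (g := fun t y => χ (γ t, y) • F (γ t, y)) (K := K)
    (fun t => by simpa [Function.comp_def] using hK.comp (LipschitzWith.prodMk_left (γ t)))
    (fun y => hG.continuous.comp (hγ.prodMk continuous_const)) (fun t y => hL _) t₀ ξ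
  refine ⟨x, hx0, fun t ht => ⟨_, hx t ht, fun hr => ?_⟩⟩
  have h1 : χ (γ t, x t) = 1 := by
    refine χ.one_of_mem_closedBall ?_
    rw [mem_closedBall_iff_norm]
    change ‖(γ t - 0, x t - e)‖ ≤ 1 + |C| + |r|
    rw [Prod.norm_mk, sub_zero]
    refine max_le ((hC t).trans ?_) (hr.le.trans ?_)
    · linarith [le_abs_self C, abs_nonneg r]
    · linarith [le_abs_self r, abs_nonneg C]
  simp [h1]

end GlobalExistence

/-! ### Continuous induction and a differential inequality -/

/-- Continuous induction for a strict bound. -/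
lemma forall_lt_of_continuousOn {φ : ℝ → ℝ} {t₀ T r : ℝ} (hφ : ContinuousOn φ (Set.Icc t₀ T))
    (hstep : ∀ t ∈ Set.Icc t₀ T, (∀ s ∈ Set.Ico t₀ t, φ s < r) → φ t < r) :
    ∀ t ∈ Set.Icc t₀ T, φ t < r := by
  by_contra! hcon
  obtain ⟨t₁, ht₁, hr⟩ := hcon
  set S := Set.Icc t₀ T ∩ φ ⁻¹' Set.Ici r with hS
  have hSc : IsClosed S := hφ.preimage_isClosed_of_isClosed isClosed_Icc isClosed_Ici
  have hSb : BddBelow S := ⟨t₀, fun s hs => hs.1.1⟩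
  -- The first time at which the bound fails is attained, because `S` is closed.
  have hmem : sInf S ∈ S := hSc.csInf_mem ⟨t₁, ht₁, hr⟩ hSb
  have := hstep (sInf S) hmem.1 fun s hs => by
    by_contra! h
    exact absurd (csInf_le hSb (show s ∈ S from ⟨⟨hs.1, hs.2.le.trans hmem.1.2⟩, h⟩))
      (not_le.2 hs.2)
  exact absurd hmem.2 (not_le.2 this)

/-- Exponential decay from a differential inequality `V' ≤ -λ V`. -/
lemma le_mul_exp_of_hasDerivAt_le {V : ℝ → ℝ} {t₀ T l : ℝ} (hV : ContinuousOn V (Set.Icc t₀ T))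
    (hd : ∀ t ∈ Set.Ioo t₀ T, ∃ V', HasDerivAt V V' t ∧ V' ≤ -l * V t) (h : t₀ ≤ T) :
    V T ≤ V t₀ * Real.exp (-l * (T - t₀)) := by
  have hder : ∀ t ∈ Set.Ioo t₀ T, ∃ U', HasDerivAt (fun t => V t * Real.exp (l * t)) U' t ∧
      U' ≤ 0 := fun t ht => by
    obtain ⟨V', h1, h2⟩ := hd t ht
    have h3 : HasDerivAt (fun t : ℝ => Real.exp (l * t)) (Real.exp (l * t) * l) t := by
      simpa using ((hasDerivAt_id t).const_mul l).exp
    refine ⟨_, h1.mul h3, ?_⟩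
    have := mul_le_mul_of_nonneg_right h2 (Real.exp_pos (l * t)).le
    nlinarith
  have hanti : AntitoneOn (fun t => V t * Real.exp (l * t)) (Set.Icc t₀ T) := by
    refine antitoneOn_of_deriv_nonpos (convex_Icc _ _) (hV.mul (by fun_prop)) ?_ ?_
    · rw [interior_Icc]
      intro t ht
      obtain ⟨U', h1, -⟩ := hder t ht
      exact h1.differentiableAt.differentiableWithinAt
    · rw [interior_Icc]
      intro t ht
      obtain ⟨U', h1, h2⟩ := hder t ht
      rwa [h1.deriv]
  have h1 := hanti (Set.left_mem_Icc.2 h) (Set.right_mem_Icc.2 h) h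
  simp only at h1
  have e : Real.exp (-l * (T - t₀)) = Real.exp (l * t₀) * (Real.exp (l * T))⁻¹ := by
    rw [← Real.exp_neg, ← Real.exp_add]; ring_nf
  rw [e, ← mul_assoc, ← div_eq_mul_inv, le_div_iff₀ (Real.exp_pos _)]
  exact h1

/-! ### Matrices as operators on Euclidean space -/

/-- The operator of a `3 × 3` matrix on Euclidean space. -/
noncomputable abbrev matOp (M : Matrix (Fin 3) (Fin 3) ℝ) :
    EuclideanSpace ℝ (Fin 3) →L[ℝ] EuclideanSpace ℝ (Fin 3) :=
  Matrix.toEuclideanCLM (𝕜 := ℝ) M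

/-- A finite sum of fixed operators with the entries as coefficients: this transfers entrywise
bounds and derivatives to operators. -/
lemma matOp_eq_sum (M : Matrix (Fin 3) (Fin 3) ℝ) :
    matOp M = ∑ i, ∑ j, M i j • matOp (Matrix.single i j 1) := by
  conv_lhs => rw [Matrix.matrix_eq_sum_single M]
  simp only [matOp, map_sum, ← map_smul, Matrix.smul_single, smul_eq_mul, mul_one]

lemma norm_matOp_le {M : Matrix (Fin 3) (Fin 3) ℝ} {C : ℝ} (hC : ∀ i j, |M i j| ≤ C) :
    ‖matOp M‖ ≤ C * ∑ i, ∑ j, ‖matOp (Matrix.single i j 1)‖ := by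
  rw [matOp_eq_sum, Finset.mul_sum]
  refine (norm_sum_le _ _).trans (Finset.sum_le_sum fun i _ => ?_)
  rw [Finset.mul_sum]
  refine (norm_sum_le _ _).trans (Finset.sum_le_sum fun j _ => ?_)
  rw [norm_smul]
  gcongr
  exact hC i j

lemma hasDerivAt_matOp {M : ℝ → Matrix (Fin 3) (Fin 3) ℝ} {M' : Matrix (Fin 3) (Fin 3) ℝ} {t : ℝ}
    (h : ∀ i j, HasDerivAt (fun s => M s i j) (M' i j) t) :
    HasDerivAt (fun s => matOp (M s)) (matOp M') t := by
  have h1 := HasDerivAt.fun_sum (u := Finset.univ) fun i _ =>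
    HasDerivAt.fun_sum (u := Finset.univ) fun j _ =>
      (h i j).smul_const (matOp (Matrix.single i j 1))
  rw [matOp_eq_sum M']
  exact h1.congr_of_eventuallyEq (Eventually.of_forall fun s => matOp_eq_sum (M s))

/-- Rayleigh bounds for a symmetric matrix. -/
lemma symmBounded_matOp {m M : ℝ} (hm : 0 ≤ m) (hM : 0 ≤ M) {A : Matrix (Fin 3) (Fin 3) ℝ}
    (hA : A.IsHermitian) (hl : ∀ i, m ≤ hA.eigenvalues i) (hu : ∀ i, hA.eigenvalues i ≤ M) :
    SymmBounded m M (matOp A) := by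
  have hsymm : ∀ x y, inner ℝ (matOp A x) y = inner ℝ x (matOp A y) := fun x y => by
    have h : star (matOp A) = matOp A := by
      rw [matOp, ← map_star, Matrix.star_eq_conjTranspose, hA.eq]
    nth_rw 1 [← h]
    rw [ContinuousLinearMap.star_eq_adjoint, ContinuousLinearMap.adjoint_inner_left]
  set b := hA.eigenvectorBasis
  have hb : ∀ i, matOp A (b i) = hA.eigenvalues i • b i := fun i => by
    refine WithLp.ofLp_injective 2 ?_
    rw [Matrix.ofLp_toEuclideanCLM]
    exact hA.mulVec_eigenvectorBasis i
  have hco : ∀ x i, inner ℝ (b i) (matOp A x) = hA.eigenvalues i * inner ℝ (b i) x := fun x i => by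
    rw [← hsymm, hb, inner_smul_left]; rfl
  have hn : ∀ x : EuclideanSpace ℝ (Fin 3), ‖x‖ ^ 2 = ∑ i, inner ℝ (b i) x ^ 2 := fun x => by
    rw [← real_inner_self_eq_norm_sq, ← b.sum_inner_mul_inner]
    exact Finset.sum_congr rfl fun i _ => by rw [real_inner_comm, sq]
  refine ⟨hsymm, fun x => ?_, fun x => ?_⟩
  · rw [hn, ← b.sum_inner_mul_inner, Finset.mul_sum]
    refine Finset.sum_le_sum fun i _ => ?_
    rw [real_inner_comm _ (matOp A x), hco, mul_assoc, ← sq]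
    exact mul_le_mul_of_nonneg_right (hl i) (sq_nonneg _)
  · refine le_of_sq_le_sq ?_ (by positivity)
    rw [mul_pow, hn, hn, Finset.mul_sum]
    refine Finset.sum_le_sum fun i _ => ?_
    rw [hco, mul_pow]
    have := hm.trans (hl i)
    gcongr
    exact hu i

lemma InertiaBounds.symmBounded {Jmin Jmax : ℝ} {J : Matrix (Fin 3) (Fin 3) ℝ}
    (h : InertiaBounds Jmin Jmax J) (hmin : 0 ≤ Jmin) (hmax : 0 ≤ Jmax) :
    SymmBounded Jmin Jmax (matOp J) :=
  let ⟨hJ, h⟩ := h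
  symmBounded_matOp hmin hmax hJ (fun i => (h i).1) fun i => (h i).2

lemma InertiaBounds.isUnit_det {Jmin Jmax : ℝ} {J : Matrix (Fin 3) (Fin 3) ℝ}
    (h : InertiaBounds Jmin Jmax J) (hmin : 0 < Jmin) : IsUnit J.det := by
  obtain ⟨hJ, h⟩ := h
  rw [hJ.det_eq_prod_eigenvalues, isUnit_iff_ne_zero]
  exact Finset.prod_ne_zero_iff.2 fun i _ => (hmin.trans_le (h i).1).ne'

lemma exists_symmBounded_of_posDef {A : Matrix (Fin 3) (Fin 3) ℝ} (hA : A.PosDef) :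
    ∃ m M : ℝ, 0 < m ∧ 0 < M ∧ SymmBounded m M (matOp A) := by
  set f := hA.1.eigenvalues
  have hpos : ∀ i, 0 < f i := hA.eigenvalues_pos
  obtain ⟨i, hi⟩ := Finite.exists_min f
  obtain ⟨j, hj⟩ := Finite.exists_max f
  exact ⟨f i, f j, hpos i, hpos j, symmBounded_matOp (hpos i).le (hpos j).le hA.1 hi hj⟩

/-! ### Quaternion estimates near the target -/

/-- The vector part of a quaternion, as a continuous linear map. -/
noncomputable def vecPart : EuclideanSpace ℝ (Fin 4) →L[ℝ] EuclideanSpace ℝ (Fin 3) :=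
  LinearMap.toContinuousLinearMap
    { toFun := fun q => WithLp.toLp 2 (quatVec q)
      map_add' := fun q r => by ext i; fin_cases i <;> simp [quatVec]
      map_smul' := fun c q => by ext i; fin_cases i <;> simp [quatVec] }

lemma ofLp_vecPart (q : EuclideanSpace ℝ (Fin 4)) : (vecPart q).ofLp = quatVec q := rfl

lemma norm_sq_three (x : EuclideanSpace ℝ (Fin 3)) : ‖x‖ ^ 2 = x 0 ^ 2 + x 1 ^ 2 + x 2 ^ 2 := by
  simp [EuclideanSpace.norm_sq_eq, Fin.sum_univ_three]

lemma norm_sq_four (q : EuclideanSpace ℝ (Fin 4)) : ‖q‖ ^ 2 = ‖vecPart q‖ ^ 2 + q 3 ^ 2 := by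
  rw [norm_sq_three]
  simp [EuclideanSpace.norm_sq_eq, Fin.sum_univ_four, ofLp_vecPart, quatVec]

/-- Lagrange's identity `‖a × b‖² = ‖a‖² ‖b‖² - ⟨a, b⟩²`. -/
lemma norm_matOp_skewMat_le (a b : EuclideanSpace ℝ (Fin 3)) :
    ‖matOp (skewMat a) b‖ ≤ ‖a‖ * ‖b‖ := by
  refine le_of_sq_le_sq ?_ (by positivity)
  rw [mul_pow, norm_sq_three, norm_sq_three, norm_sq_three]
  simp [Matrix.ofLp_toEuclideanCLM, skewMat, Matrix.mulVec, dotProduct, Fin.sum_univ_three]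
  nlinarith [sq_nonneg (a 0 * b 0 + a 1 * b 1 + a 2 * b 2)]

/-- Near the identity quaternion the attitude matrix is near the identity matrix. -/
lemma norm_matOp_attitudeMat_sub_one_le {q : EuclideanSpace ℝ (Fin 4)} (hq : ‖q‖ = 1) :
    ‖matOp (attitudeMat q) - 1‖ ≤ 6 * ‖vecPart q‖ := by
  have hq' := norm_sq_four q
  rw [hq, one_pow] at hq'
  have ha0 := norm_nonneg (vecPart q)
  have ha1 : ‖vecPart q‖ ≤ 1 := by nlinarith [sq_nonneg (q 3)]
  have hq3 : |q 3| ≤ 1 := by rw [← sq_le_one_iff_abs_le_one]; nlinarith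
  refine ContinuousLinearMap.opNorm_le_bound _ (by positivity) fun v => ?_
  -- Here `q₄² = 1 - ‖q_v‖²` is used. Each of the three terms is at most `2 ‖q_v‖ ‖v‖`, whence the
  -- constant `6`.
  have e : (matOp (attitudeMat q) - 1) v = (-2 * ‖vecPart q‖ ^ 2) • v
      + (2 * inner ℝ (vecPart q) v) • vecPart q
      - (2 * q 3) • matOp (skewMat (vecPart q)) v := by
    have h3 : q 3 ^ 2 - quatVec q ⬝ᵥ quatVec q = 1 - 2 * ‖vecPart q‖ ^ 2 := by
      have : quatVec q ⬝ᵥ quatVec q = ‖vecPart q‖ ^ 2 := by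
        rw [norm_sq_three, ofLp_vecPart]; simp [dotProduct, Fin.sum_univ_three]; ring
      rw [this]; linarith
    have h4 : matOp (vecMulVec (quatVec q) (quatVec q)) v = inner ℝ (vecPart q) v • vecPart q := by
      ext i
      rw [Matrix.ofLp_toEuclideanCLM, Matrix.vecMulVec_mulVec]
      simp [PiLp.inner_apply, dotProduct, ofLp_vecPart, mul_comm]
    rw [attitudeMat, h3]
    simp only [matOp, map_sub, map_add, map_smul, map_one, _root_.sub_apply,
      _root_.add_apply, _root_.smul_apply, one_apply_eq_self] at h4 ⊢
    rw [h4, ofLp_vecPart]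
    module
  rw [e]
  have n1 : ‖(-2 * ‖vecPart q‖ ^ 2) • v‖ ≤ 2 * (‖vecPart q‖ * ‖v‖) := by
    rw [norm_smul, Real.norm_eq_abs, abs_mul, abs_of_nonneg (sq_nonneg ‖vecPart q‖)]
    norm_num
    have : ‖vecPart q‖ ^ 2 ≤ ‖vecPart q‖ := by nlinarith
    nlinarith [norm_nonneg v]
  have n2 : ‖(2 * inner ℝ (vecPart q) v) • vecPart q‖ ≤ 2 * (‖vecPart q‖ * ‖v‖) := by
    rw [norm_smul, Real.norm_eq_abs, abs_mul, abs_two]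
    have := abs_real_inner_le_norm (vecPart q) v
    calc 2 * |inner ℝ (vecPart q) v| * ‖vecPart q‖ ≤ 2 * (‖vecPart q‖ * ‖v‖) * 1 := by gcongr
      _ = _ := mul_one _
  have n3 : ‖(2 * q 3) • matOp (skewMat (vecPart q)) v‖ ≤ 2 * (‖vecPart q‖ * ‖v‖) := by
    rw [norm_smul, Real.norm_eq_abs, abs_mul, abs_two]
    calc 2 * |q 3| * ‖matOp (skewMat (vecPart q)) v‖ ≤ 2 * 1 * (‖vecPart q‖ * ‖v‖) := by
          gcongr; exact norm_matOp_skewMat_le _ _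
      _ = _ := by ring
  have := norm_sub_le ((-2 * ‖vecPart q‖ ^ 2) • v + (2 * inner ℝ (vecPart q) v) • vecPart q)
    ((2 * q 3) • matOp (skewMat (vecPart q)) v)
  have := norm_add_le ((-2 * ‖vecPart q‖ ^ 2) • v) ((2 * inner ℝ (vecPart q) v) • vecPart q)
  linarith

/-- Conjugation by an element near the identity. -/
lemma norm_conj_sub_le {R : Type*} [NormedRing R] [NormOneClass R] [StarRing R]
    [NormedStarGroup R] {A Γ : R} {d g : ℝ} (hd1 : d ≤ 6) (hA : ‖A - 1‖ ≤ d) (hΓ : ‖Γ‖ ≤ g) : ‖A * Γ * star A - Γ‖ ≤ 8 * d * g := by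
  have e : A * Γ * star A - Γ = (A - 1) * Γ * star A + Γ * star (A - 1) := by
    rw [star_sub, star_one]; noncomm_ring
  have hd : 0 ≤ d := (norm_nonneg _).trans hA
  have hg : 0 ≤ g := (norm_nonneg _).trans hΓ
  have hs : ‖star (A - 1)‖ ≤ d := by rwa [norm_star]
  -- `7 = 6 + 1`, where `6` bounds `d`; the two terms of the splitting `e` then add up to `8 d g`.
  have hsA : ‖star A‖ ≤ 7 := by
    rw [norm_star]
    have h := norm_add_le (A - 1) 1
    rw [sub_add_cancel, norm_one] at h
    linarith
  rw [e]
  calc ‖(A - 1) * Γ * star A + Γ * star (A - 1)‖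
      ≤ ‖A - 1‖ * ‖Γ‖ * ‖star A‖ + ‖Γ‖ * ‖star (A - 1)‖ := by
        refine (norm_add_le _ _).trans (add_le_add ?_ (norm_mul_le _ _))
        exact (norm_mul_le _ _).trans (by gcongr; exact norm_mul_le _ _)
    _ ≤ d * g * 7 + g * d := by gcongr
    _ = 8 * d * g := by ring

/-- The kinematics preserve the norm of the quaternion. -/
lemma inner_eq_zero_of_kinMat {q v : EuclideanSpace ℝ (Fin 4)} {ω : Fin 3 → ℝ}
    (h : v.ofLp = kinMat q *ᵥ ω) : inner ℝ q v = 0 := by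
  have h' := fun i => congrFun h i
  simp only [PiLp.inner_apply, Fin.sum_univ_four, h']
  simp [kinMat, Matrix.mulVec, dotProduct, Fin.sum_univ_three]
  ring

/-- The kinematics of the vector part. -/
lemma vecPart_eq_of_kinMat {q v : EuclideanSpace ℝ (Fin 4)} {ω : EuclideanSpace ℝ (Fin 3)}
    (h : v.ofLp = kinMat q *ᵥ ω.ofLp) :
    vecPart v = (1 / 2 : ℝ) • (q 3 • ω + matOp (skewMat (vecPart q)) ω) := by
  have h' := fun i => congrFun h i
  ext i
  rw [ofLp_vecPart]
  fin_cases i <;>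
  · simp [quatVec, h', Matrix.ofLp_toEuclideanCLM]
    simp [kinMat, skewMat, ofLp_vecPart, quatVec, Matrix.mulVec, dotProduct, Fin.sum_univ_three]
    try ring

/-- The dynamics of the angular velocity, in operator form. -/
lemma closedLoop.op_eq {J : Matrix (Fin 3) (Fin 3) ℝ} {Γ : ℝ → Matrix (Fin 3) (Fin 3) ℝ}
    {k₁ k₂ ε t : ℝ} {x v : AttState} (h : closedLoop J Γ k₁ k₂ ε t x v) :
    matOp J v.2 = -(matOp (skewMat x.2) (matOp J x.2))
      - (matOp (attitudeMat x.1) * matOp (Γ t) * star (matOp (attitudeMat x.1)))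
          ((ε ^ 2 * k₁) • vecPart x.1 + (ε * k₂) • x.2) := by
  have e : matOp (attitudeMat x.1) * matOp (Γ t) * star (matOp (attitudeMat x.1))
      = matOp (attitudeMat x.1 * Γ t * (attitudeMat x.1)ᵀ) := by
    simp only [matOp, map_mul, ← map_star, Matrix.star_eq_conjTranspose,
      Matrix.conjTranspose_eq_transpose_of_trivial]
  rw [e]
  ext1
  simp only [WithLp.ofLp_sub, WithLp.ofLp_neg, WithLp.ofLp_add, WithLp.ofLp_smul,
    Matrix.ofLp_toEuclideanCLM, ofLp_vecPart]
  rw [h.2, pdLaw, Matrix.mulVec_neg, sub_eq_add_neg]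

lemma norm_sub_targetState (x : AttState) :
    ‖x - targetState‖ = max ‖x.1 - targetState.1‖ ‖x.2‖ := by
  rw [Prod.norm_def]; simp [targetState]

lemma norm_sub_target_sq (q : EuclideanSpace ℝ (Fin 4)) :
    ‖q - targetState.1‖ ^ 2 = ‖vecPart q‖ ^ 2 + (q 3 - 1) ^ 2 := by
  rw [norm_sq_four, map_sub]
  have h : vecPart targetState.1 = 0 := by
    ext i; rw [ofLp_vecPart]; fin_cases i <;> simp [quatVec, targetState]
  rw [h, sub_zero]
  simp [targetState]

lemma norm_vecPart_le_norm_sub_targetState (x : AttState) : ‖vecPart x.1‖ ≤ ‖x - targetState‖ := by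
  refine le_trans ?_ ((le_max_left _ _).trans (norm_sub_targetState x).ge)
  refine le_of_sq_le_sq ?_ (norm_nonneg _)
  rw [norm_sub_target_sq]; nlinarith

lemma abs_sub_one_le_norm_sub_targetState (x : AttState) : |x.1 3 - 1| ≤ ‖x - targetState‖ := by
  refine le_trans ?_ ((le_max_left _ _).trans (norm_sub_targetState x).ge)
  refine abs_le_of_sq_le_sq ?_ (norm_nonneg _)
  rw [norm_sub_target_sq]; nlinarith [sq_nonneg ‖vecPart x.1‖]

lemma norm_snd_le_norm_sub_targetState (x : AttState) : ‖x.2‖ ≤ ‖x - targetState‖ :=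
  (le_max_right _ _).trans (norm_sub_targetState x).ge

/-- On unit quaternions near the identity, the vector part controls the distance. -/
lemma norm_sub_targetState_le {x : AttState} (hx : ‖x.1‖ = 1) (h : ‖x - targetState‖ ≤ 1) :
    ‖x - targetState‖ ≤ 2 * ‖vecPart x.1‖ + ‖x.2‖ := by
  -- This gives `q₄ ≥ 0`, which excludes the antipode `-q̄`. Then `(1 - q₄)² ≤ (1 - q₄)(1 + q₄) =
  -- ‖q_v‖²`.
  have h3 := (abs_le.1 ((abs_sub_one_le_norm_sub_targetState x).trans h)).1
  rw [norm_sub_targetState]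
  refine max_le ?_ (by linarith [norm_nonneg (vecPart x.1)])
  have h1 : ‖x.1 - targetState.1‖ ≤ 2 * ‖vecPart x.1‖ := by
    refine le_of_sq_le_sq ?_ (by positivity)
    rw [norm_sub_target_sq]
    have := norm_sq_four x.1
    rw [hx] at this
    nlinarith
  linarith [norm_nonneg x.2]

/-! ### From a Lyapunov function to local exponential stability -/

section LyapunovTheorem

variable {E : Type*} [NormedAddCommGroup E] [NormedSpace ℝ E]

/-- A Lyapunov function which is quadratically bounded near `e` and decays exponentially along the
solutions near `e` gives local exponential stability. Existence is only asked for a relation which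
agrees with `F` near `e`. -/
lemma locExpStableWith_of_lyapunov {F : ℝ → E → E → Prop} {S : Set E} {e : E} {r α β l : ℝ}
    (hr : 0 < r) (hα : 0 < α) (hβ : 0 < β) (hl : 0 < l) {V : ℝ → E → ℝ}
    (hVc : Continuous fun p : ℝ × E => V p.1 p.2)
    (hinv : ∀ (t₀ T : ℝ) (x : ℝ → E), t₀ ≤ T → x t₀ ∈ S → ContinuousOn x (Set.Icc t₀ T) →
      (∀ t ∈ Set.Ioo t₀ T, ∃ v, HasDerivAt x v t ∧ F t (x t) v) → x T ∈ S)
    (hlow : ∀ t, ∀ x ∈ S, ‖x - e‖ ≤ r → α * ‖x - e‖ ^ 2 ≤ V t x)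
    (hup : ∀ t x, V t x ≤ β * ‖x - e‖ ^ 2)
    (hder : ∀ (x : ℝ → E) (t : ℝ) (v : E), HasDerivAt x v t → x t ∈ S → ‖x t - e‖ < r →
      F t (x t) v → ∃ V', HasDerivAt (fun s => V s (x s)) V' t ∧ V' ≤ -l * V t (x t))
    (hex : ∀ (t₀ : ℝ) (ξ : E), ∃ x : ℝ → E, x t₀ = ξ ∧ ∀ t ∈ Set.Ici t₀, ∃ v,
      HasDerivWithinAt x v (Set.Ici t₀) t ∧ (‖x t - e‖ < r → F t (x t) v)) :
    LocExpStableWith F S e (r / (√(β / α) + 1)) (√(β / α)) (l / 2) := by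
  set k := √(β / α) with hk
  have hk0 : 0 < k := Real.sqrt_pos.2 (div_pos hβ hα)
  have hcr : r / (k + 1) ≤ r := div_le_self hr.le (by linarith)
  -- The decay estimate up to `t₁`, assuming the solution stays in the open ball before `t₁`; at
  -- `t₁` itself the closed ball is enough.
  have bound : ∀ (t₀ t₁ : ℝ) (x : ℝ → E), t₀ ≤ t₁ → x t₀ ∈ S → ContinuousOn x (Set.Icc t₀ t₁) →
      (∀ t ∈ Set.Ioo t₀ t₁, ‖x t - e‖ < r ∧ ∃ v, HasDerivAt x v t ∧ F t (x t) v) →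
      ‖x t₁ - e‖ ≤ r → x t₁ ∈ S ∧
        ‖x t₁ - e‖ ≤ k * ‖x t₀ - e‖ * Real.exp (-(l / 2) * (t₁ - t₀)) := by
    intro t₀ t₁ x h01 hx0 hxc hx hr1
    have hS : ∀ s ∈ Set.Icc t₀ t₁, x s ∈ S := fun s hs =>
      hinv t₀ s x hs.1 hx0 (hxc.mono (Set.Icc_subset_Icc_right hs.2))
        fun t ht => (hx t ⟨ht.1, ht.2.trans_le hs.2⟩).2
    have hS1 := hS t₁ (Set.right_mem_Icc.2 h01)
    refine ⟨hS1, ?_⟩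
    have hdecay := le_mul_exp_of_hasDerivAt_le (V := fun s => V s (x s)) (l := l)
      (hVc.comp_continuousOn (continuousOn_id.prodMk hxc)) (fun t ht => by
        obtain ⟨hlt, v, hv, hF⟩ := hx t ht
        exact hder x t v hv (hS t ⟨ht.1.le, ht.2.le⟩) hlt hF) h01
    have h1 := (hlow t₁ _ hS1 hr1).trans hdecay
    have h2 := mul_le_mul_of_nonneg_right (hup t₀ (x t₀)) (Real.exp_pos (-l * (t₁ - t₀))).le
    refine le_of_sq_le_sq ?_ (by positivity)
    have hsq : Real.exp (-(l / 2) * (t₁ - t₀)) ^ 2 = Real.exp (-l * (t₁ - t₀)) := by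
      rw [← Real.exp_nat_mul]; congr 1; push_cast; ring
    rw [mul_pow, mul_pow, hsq, hk, Real.sq_sqrt (div_pos hβ hα).le]
    have h3 : ‖x t₁ - e‖ ^ 2 ≤ β * ‖x t₀ - e‖ ^ 2 * Real.exp (-l * (t₁ - t₀)) / α := by
      rw [le_div_iff₀ hα]; linarith
    refine h3.trans (le_of_eq ?_)
    ring
  have stay : ∀ (t₀ T : ℝ) (x : ℝ → E), x t₀ ∈ S → ‖x t₀ - e‖ < r / (k + 1) →
      (∀ t ∈ Set.Icc t₀ T, ∃ v, HasDerivWithinAt x v (Set.Icc t₀ T) t ∧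
        (‖x t - e‖ < r → F t (x t) v)) →
      ∀ t ∈ Set.Icc t₀ T, ‖x t - e‖ < r ∧ x t ∈ S ∧
        ‖x t - e‖ ≤ k * ‖x t₀ - e‖ * Real.exp (-(l / 2) * (t - t₀)) := by
    intro t₀ T x hx0 hc hx
    have hxc : ContinuousOn x (Set.Icc t₀ T) := fun t ht =>
      let ⟨v, hv, _⟩ := hx t ht
      hv.continuousWithinAt
    have hφc : ContinuousOn (fun t => ‖x t - e‖) (Set.Icc t₀ T) :=
      (hxc.sub continuousOn_const).norm
    have hd : ∀ t₁ ∈ Set.Icc t₀ T, (∀ s ∈ Set.Ico t₀ t₁, ‖x s - e‖ < r) →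
        ∀ t ∈ Set.Ioo t₀ t₁, ‖x t - e‖ < r ∧ ∃ v, HasDerivAt x v t ∧ F t (x t) v := by
      intro t₁ ht₁ hs t ht
      have hlt := hs t ⟨ht.1.le, ht.2⟩
      have htT : t < T := ht.2.trans_le ht₁.2
      obtain ⟨v, hv, hF⟩ := hx t ⟨ht.1.le, htT.le⟩
      exact ⟨hlt, v, hv.hasDerivAt (Icc_mem_nhds ht.1 htT), hF hlt⟩
    have hlt : ∀ t ∈ Set.Icc t₀ T, ‖x t - e‖ < r := by
      refine forall_lt_of_continuousOn hφc fun t₁ ht₁ hs => ?_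
      rcases ht₁.1.eq_or_lt with rfl | h01
      · exact hc.trans_le hcr
      -- The strict bound before `t₁` passes to the limit as a weak one. This suffices for `bound`,
      -- which returns a strict bound since `k ‖x t₀ - e‖ < r`.
      have hle : ‖x t₁ - e‖ ≤ r := by
        have h1 : ContinuousWithinAt (fun t => ‖x t - e‖) (Set.Ico t₀ t₁) t₁ :=
          (hφc t₁ ht₁).mono (Set.Ico_subset_Icc_self.trans (Set.Icc_subset_Icc_right ht₁.2))
        have h2 : t₁ ∈ closure (Set.Ico t₀ t₁) := by
          rw [closure_Ico h01.ne]; exact Set.right_mem_Icc.2 h01.le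
        exact h1.closure_le h2 continuousWithinAt_const fun s hs' => (hs s hs').le
      have h1 := (bound t₀ t₁ x ht₁.1 hx0 (hxc.mono (Set.Icc_subset_Icc_right ht₁.2))
        (hd t₁ ht₁ hs) hle).2
      have h2 : Real.exp (-(l / 2) * (t₁ - t₀)) ≤ 1 := Real.exp_le_one_iff.2 (by nlinarith)
      have h3 : k * ‖x t₀ - e‖ * Real.exp (-(l / 2) * (t₁ - t₀)) ≤ k * ‖x t₀ - e‖ :=
        mul_le_of_le_one_right (by positivity) h2
      have h4 : (k + 1) * ‖x t₀ - e‖ < r := by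
        rw [mul_comm]; exact (lt_div_iff₀ (by linarith)).1 hc
      linarith [norm_nonneg (x t₀ - e)]
    exact fun t ht => ⟨hlt t ht, bound t₀ t x ht.1 hx0 (hxc.mono (Set.Icc_subset_Icc_right ht.2))
      (hd t ht fun s hs => hlt s ⟨hs.1, hs.2.le.trans ht.2⟩) (hlt t ht).le⟩
  intro t₀ _ ξ hξ hc
  constructor
  · obtain ⟨x, hx0, hx⟩ := hex t₀ ξ
    have key : ∀ t, t₀ ≤ t → ‖x t - e‖ < r ∧ x t ∈ S := fun t ht =>
      have h := stay t₀ t x (hx0 ▸ hξ) (hx0 ▸ hc) (fun s hs =>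
        let ⟨v, hv, hF⟩ := hx s hs.1
        ⟨v, hv.mono Set.Icc_subset_Ici_self, hF⟩) t (Set.right_mem_Icc.2 ht)
      ⟨h.1, h.2.1⟩
    refine ⟨x, hx0, fun t ht => ?_, fun t ht => (key t ht).2⟩
    obtain ⟨v, hv, hF⟩ := hx t ht
    exact ⟨v, hv, hF (key t ht).1⟩
  · intro T x hx0 hx t ht
    have h := (stay t₀ T x (hx0 ▸ hξ) (hx0 ▸ hc) (fun s hs =>
      let ⟨v, hv, hF⟩ := hx s hs
      ⟨v, hv, fun _ => hF⟩) t ht).2.2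
    rwa [hx0] at h

end LyapunovTheorem

/-! ### The closed loop as a `C¹` vector field, and its invariant unit quaternions -/

section ClosedLoopField

variable {X : Type*} [NormedAddCommGroup X] [NormedSpace ℝ X] {l m n : Type*} [Fintype m]

lemma contDiff_matrix_mul {A : X → Matrix l m ℝ} {B : X → Matrix m n ℝ}
    (hA : ∀ i j, ContDiff ℝ 1 fun x => A x i j) (hB : ∀ i j, ContDiff ℝ 1 fun x => B x i j)
    (i : l) (j : n) : ContDiff ℝ 1 fun x => (A x * B x) i j := by
  simp only [Matrix.mul_apply]
  exact ContDiff.sum fun k _ => (hA i k).mul (hB k j)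

lemma contDiff_matrix_mulVec {A : X → Matrix l m ℝ} {b : X → m → ℝ}
    (hA : ∀ i j, ContDiff ℝ 1 fun x => A x i j) (hb : ∀ i, ContDiff ℝ 1 fun x => b x i) (i : l) :
    ContDiff ℝ 1 fun x => (A x *ᵥ b x) i := by
  simp only [Matrix.mulVec, dotProduct]
  exact ContDiff.sum fun k _ => (hA i k).mul (hb k)

/-- The closed loop solved for the derivative, as a function of `Γ` and the state. -/
noncomputable def closedLoopField (J : Matrix (Fin 3) (Fin 3) ℝ) (k₁ k₂ ε : ℝ)
    (p : (Fin 3 → Fin 3 → ℝ) × AttState) : AttState :=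
  (WithLp.toLp 2 (kinMat p.2.1 *ᵥ p.2.2.ofLp),
   WithLp.toLp 2 (J⁻¹ *ᵥ (-(skewMat p.2.2 *ᵥ (J *ᵥ p.2.2.ofLp))
    + (attitudeMat p.2.1 * Matrix.of p.1 * (attitudeMat p.2.1)ᵀ) *ᵥ pdLaw k₁ k₂ ε p.2)))

lemma closedLoop_closedLoopField {J : Matrix (Fin 3) (Fin 3) ℝ} (hJ : IsUnit J.det)
    (Γ : ℝ → Matrix (Fin 3) (Fin 3) ℝ) (k₁ k₂ ε t : ℝ) (x : AttState) :
    closedLoop J Γ k₁ k₂ ε t x (closedLoopField J k₁ k₂ ε (Γ t, x)) := by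
  refine ⟨rfl, ?_⟩
  simp only [closedLoopField, Matrix.mulVec_mulVec, Matrix.mul_nonsing_inv J hJ, Matrix.one_mulVec]
  rfl

/-- Every component is polynomial in `Γ` and the state. Treating `Γ` as a variable confines the time
dependence to a bounded parameter, as `exists_curve_solution_in_ball` requires. -/
lemma contDiff_closedLoopField (J : Matrix (Fin 3) (Fin 3) ℝ) (k₁ k₂ ε : ℝ) :
    ContDiff ℝ 1 (closedLoopField J k₁ k₂ ε) := by
  have hq : ∀ i, ContDiff ℝ 1 fun p : (Fin 3 → Fin 3 → ℝ) × AttState => p.2.1 i :=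
    fun i => by fun_prop
  have hω : ∀ i, ContDiff ℝ 1 fun p : (Fin 3 → Fin 3 → ℝ) × AttState => p.2.2 i :=
    fun i => by fun_prop
  have hΓ : ∀ i j, ContDiff ℝ 1 fun p : (Fin 3 → Fin 3 → ℝ) × AttState => Matrix.of p.1 i j :=
    fun i j => by simp only [Matrix.of_apply]; fun_prop
  have hv : ∀ i, ContDiff ℝ 1 fun p : (Fin 3 → Fin 3 → ℝ) × AttState => quatVec p.2.1 i := by
    intro i; fin_cases i
    exacts [hq 0, hq 1, hq 2]
  have hskew : ∀ f : (Fin 3 → Fin 3 → ℝ) × AttState → Fin 3 → ℝ,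
      (∀ i, ContDiff ℝ 1 fun p => f p i) → ∀ i j, ContDiff ℝ 1 fun p => skewMat (f p) i j := by
    intro f hf i j
    fin_cases i <;> fin_cases j <;>
      first | exact contDiff_const | exact hf _ | exact (hf _).neg
  have hA : ∀ i j, ContDiff ℝ 1 fun p : (Fin 3 → Fin 3 → ℝ) × AttState =>
      attitudeMat p.2.1 i j := by
    intro i j
    simp only [attitudeMat, Matrix.add_apply, Matrix.sub_apply, Matrix.smul_apply,
      Matrix.vecMulVec_apply, smul_eq_mul, dotProduct]
    have h1 := hskew _ hv i j
    have h2 : ContDiff ℝ 1 fun p : (Fin 3 → Fin 3 → ℝ) × AttState =>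
        ∑ i, quatVec p.2.1 i * quatVec p.2.1 i := ContDiff.sum fun k _ => (hv k).mul (hv k)
    exact (((((hq 3).pow 2).sub h2).mul contDiff_const).add
      (contDiff_const.mul ((hv i).mul (hv j)))).sub ((contDiff_const.mul (hq 3)).mul h1)
  have hK : ∀ i j, ContDiff ℝ 1 fun p : (Fin 3 → Fin 3 → ℝ) × AttState => kinMat p.2.1 i j := by
    intro i j
    simp only [kinMat, Matrix.smul_apply, smul_eq_mul]
    refine contDiff_const.mul ?_
    fin_cases i <;> fin_cases j <;> first | exact hq _ | exact (hq _).neg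
  have hu : ∀ i, ContDiff ℝ 1 fun p : (Fin 3 → Fin 3 → ℝ) × AttState =>
      pdLaw k₁ k₂ ε p.2 i := fun i =>
    ((contDiff_const.mul (hv i)).add (contDiff_const.mul (hω i))).neg
  refine ContDiff.prodMk ?_ ?_
  · exact (contDiff_euclidean (𝕜 := ℝ)).2 (contDiff_matrix_mulVec hK hω)
  · refine (contDiff_euclidean (𝕜 := ℝ)).2
      (contDiff_matrix_mulVec (A := fun _ => J⁻¹) (fun _ _ => contDiff_const) fun i => ?_)
    refine ContDiff.add (contDiff_matrix_mulVec (hskew _ hω)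
      (contDiff_matrix_mulVec (A := fun _ => J) (fun _ _ => contDiff_const) hω) i).neg ?_
    exact contDiff_matrix_mulVec
      (contDiff_matrix_mul (contDiff_matrix_mul hA hΓ) fun i j => hA j i) hu i

end ClosedLoopField

/-- The closed loop preserves unit quaternions. -/
lemma closedLoop_mem_unitStates {J : Matrix (Fin 3) (Fin 3) ℝ} {Γ : ℝ → Matrix (Fin 3) (Fin 3) ℝ}
    {k₁ k₂ ε t₀ T : ℝ} {x : ℝ → AttState} (h : t₀ ≤ T) (hx0 : x t₀ ∈ unitStates)
    (hxc : ContinuousOn x (Set.Icc t₀ T))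
    (hx : ∀ t ∈ Set.Ioo t₀ T, ∃ v, HasDerivAt x v t ∧ closedLoop J Γ k₁ k₂ ε t (x t) v) :
    x T ∈ unitStates := by
  have hd : ∀ t ∈ Set.Ioo t₀ T, HasDerivAt (fun s => ‖(x s).1‖ ^ 2) 0 t := fun t ht => by
    obtain ⟨v, hv, hF⟩ := hx t ht
    have h1 : HasDerivAt (fun s => (x s).1) v.1 t :=
      (ContinuousLinearMap.fst ℝ (EuclideanSpace ℝ (Fin 4)) (EuclideanSpace ℝ (Fin 3))).hasFDerivAt.comp_hasDerivAt
        t hv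
    refine h1.norm_sq.congr_deriv ?_
    rw [inner_eq_zero_of_kinMat hF.1, mul_zero]
  have hc : ContinuousOn (fun s => ‖(x s).1‖ ^ 2) (Set.Icc t₀ T) :=
    ((continuous_fst.comp_continuousOn hxc).norm).pow 2
  have h1 : ‖(x T).1‖ ^ 2 = ‖(x t₀).1‖ ^ 2 := by
    rcases h.eq_or_lt with rfl | h
    · rfl
    obtain ⟨c, hc, he⟩ := exists_hasDerivAt_eq_slope _ _ h hc hd
    have hne : T - t₀ ≠ 0 := sub_ne_zero.2 h.ne'
    field_simp at he
    linarith
  change ‖(x T).1‖ = 1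
  rw [show ‖(x t₀).1‖ = 1 from hx0, one_pow] at h1
  nlinarith [norm_nonneg (x T).1]

/-! ### The closed loop as a perturbation of the averaged linear system -/

section Perturbation

variable {J : Matrix (Fin 3) (Fin 3) ℝ} {Γ : ℝ → Matrix (Fin 3) (Fin 3) ℝ} {k₁ k₂ ε t : ℝ}
  {x v : AttState}

/-- The kinematics of the vector part, as a perturbation of `a' = (ε / 2) z` with `ω = ε z`. -/
lemma closedLoop.exists_vecPart_eq (h : closedLoop J Γ k₁ k₂ ε t x v) (hε : 0 < ε) :
    ∃ r : EuclideanSpace ℝ (Fin 3),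
      vecPart v.1 = (ε / 2) • (ε⁻¹ • x.2) + ε • r ∧
      ‖r‖ ≤ ‖x - targetState‖ * ‖ε⁻¹ • x.2‖ := by
  set z := ε⁻¹ • x.2 with hz
  have hω : x.2 = ε • z := by rw [hz, smul_inv_smul₀ hε.ne']
  refine ⟨(1 / 2 : ℝ) • ((x.1 3 - 1) • z + matOp (skewMat (vecPart x.1)) z), ?_, ?_⟩
  · rw [vecPart_eq_of_kinMat h.1, hω, map_smul]
    module
  · have h1 : ‖(x.1 3 - 1) • z‖ ≤ ‖x - targetState‖ * ‖z‖ := by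
      rw [norm_smul, Real.norm_eq_abs]
      gcongr
      exact abs_sub_one_le_norm_sub_targetState x
    have h2 : ‖matOp (skewMat (vecPart x.1)) z‖ ≤ ‖x - targetState‖ * ‖z‖ :=
      (norm_matOp_skewMat_le _ _).trans
        (by gcongr; exact norm_vecPart_le_norm_sub_targetState x)
    have h3 := norm_add_le ((x.1 3 - 1) • z) (matOp (skewMat (vecPart x.1)) z)
    rw [norm_smul, Real.norm_of_nonneg (by norm_num)]
    linarith

/-- The dynamics of the angular velocity, as a perturbation of `J z' = -ε Γ (k₁ a + k₂ z)` with
`ω = ε z`. -/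
lemma closedLoop.exists_momentum_eq (h : closedLoop J Γ k₁ k₂ ε t x v) (hε : 0 < ε)
    (hk₁ : 0 < k₁) (hk₂ : 0 < k₂) (hx : ‖x.1‖ = 1) {Jmin Jmax g : ℝ} (hJmax : 0 ≤ Jmax)
    (hJ : SymmBounded Jmin Jmax (matOp J)) (hg : ‖matOp (Γ t)‖ ≤ g) (hx1 : ‖x - targetState‖ ≤ 1) :
    ∃ N : EuclideanSpace ℝ (Fin 3),
      matOp J (ε⁻¹ • v.2)
        = -(ε • matOp (Γ t) (k₁ • vecPart x.1 + k₂ • (ε⁻¹ • x.2))) + ε • N ∧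
      ‖N‖ ≤ ‖x - targetState‖ * (Jmax / ε + 48 * g * (k₁ + k₂))
        * (‖vecPart x.1‖ + ‖ε⁻¹ • x.2‖) := by
  set z := ε⁻¹ • x.2 with hz
  set a := vecPart x.1 with ha
  set ρ := ‖x - targetState‖ with hρ
  have hρ0 : 0 ≤ ρ := norm_nonneg _
  have hω : x.2 = ε • z := by rw [hz, smul_inv_smul₀ hε.ne']
  set w := k₁ • a + k₂ • z with hw
  set C := matOp (attitudeMat x.1) * matOp (Γ t) * star (matOp (attitudeMat x.1)) with hC
  have hwn : ‖w‖ ≤ (k₁ + k₂) * (‖a‖ + ‖z‖) := by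
    refine (norm_add_le _ _).trans ?_
    rw [norm_smul, norm_smul, Real.norm_of_nonneg hk₁.le, Real.norm_of_nonneg hk₂.le]
    nlinarith [norm_nonneg a, norm_nonneg z]
  have haρ : ‖a‖ ≤ ρ := norm_vecPart_le_norm_sub_targetState x
  have hg0 : 0 ≤ g := (norm_nonneg _).trans hg
  have hzρ : ‖z‖ ≤ ρ / ε := by
    rw [hz, norm_smul, norm_inv, Real.norm_of_nonneg hε.le, ← div_eq_inv_mul]
    gcongr
    exact norm_snd_le_norm_sub_targetState x
  -- The gyroscopic term, whose factor `ε⁻¹` is compensated only by a small neighbourhood, and the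
  -- error of replacing `A Γ Aᵀ` by `Γ`. In the bound, `48 = 8 · 6`.
  refine ⟨-(ε⁻¹ • matOp (skewMat x.2) (matOp J z)) - (C - matOp (Γ t)) w, ?_, ?_⟩
  · rw [map_smul, h.op_eq, ← hC, ← ha]
    have h1 : (ε ^ 2 * k₁) • a + (ε * k₂) • x.2 = ε ^ 2 • w := by
      rw [hw, hω]; module
    rw [h1, map_smul, _root_.sub_apply]
    have h2 : matOp J x.2 = ε • matOp J z := by rw [← map_smul, ← hω]
    rw [h2, map_smul, smul_sub, smul_neg, smul_sub, smul_neg, smul_sub, smul_smul, smul_smul,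
      smul_smul, inv_mul_cancel₀ hε.ne', mul_inv_cancel₀ hε.ne']
    have h3 : ε⁻¹ * ε ^ 2 = ε := by field_simp
    rw [h3]
    abel
  · have n1 : ‖ε⁻¹ • matOp (skewMat x.2) (matOp J z)‖ ≤ ρ * (Jmax / ε) * (‖a‖ + ‖z‖) := by
      have h2 := hJ.upper z
      have h3 := norm_snd_le_norm_sub_targetState x
      rw [norm_smul, norm_inv, Real.norm_of_nonneg hε.le]
      calc ε⁻¹ * ‖matOp (skewMat x.2) (matOp J z)‖ ≤ ε⁻¹ * (ρ * (Jmax * ‖z‖)) := by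
            gcongr
            exact (norm_matOp_skewMat_le _ _).trans (by gcongr)
        _ = ρ * (Jmax / ε) * ‖z‖ := by ring
        _ ≤ ρ * (Jmax / ε) * (‖a‖ + ‖z‖) := by
            gcongr; linarith [norm_nonneg a]
    have n2 : ‖(C - matOp (Γ t)) w‖ ≤ ρ * (48 * g * (k₁ + k₂)) * (‖a‖ + ‖z‖) := by
      have h1 : ‖C - matOp (Γ t)‖ ≤ 8 * (6 * ρ) * g :=
        norm_conj_sub_le (by linarith)
          ((norm_matOp_attitudeMat_sub_one_le hx).trans (by gcongr)) hg
      calc ‖(C - matOp (Γ t)) w‖ ≤ 8 * (6 * ρ) * g * ((k₁ + k₂) * (‖a‖ + ‖z‖)) :=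
            ContinuousLinearMap.le_of_opNorm_le_of_le _ h1 hwn
        _ = _ := by ring
    have h3 := norm_sub_le (-(ε⁻¹ • matOp (skewMat x.2) (matOp J z))) ((C - matOp (Γ t)) w)
    rw [norm_neg] at h3
    linarith

/-- Near the target the derivative of `y = J z + ε H (k₁ a + k₂ z)`, where `ω = ε z` and
`H' = Γ - G`, is a small perturbation of `-ε G (k₁ a + k₂ z)`. -/
lemma closedLoop.exists_averaged_eq (h : closedLoop J Γ k₁ k₂ ε t x v) (hε : 0 < ε)
    (hk₁ : 0 < k₁) (hk₂ : 0 < k₂) (hx : ‖x.1‖ = 1) {Jmin Jmax g B η : ℝ} (hJmin : 0 < Jmin)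
    (hJmax : 0 ≤ Jmax) (hJ : SymmBounded Jmin Jmax (matOp J)) (hg : ‖matOp (Γ t)‖ ≤ g)
    (hx1 : ‖x - targetState‖ ≤ 1) (hη1 : η ≤ 1)
    (hxη : ‖x - targetState‖ * (Jmax / ε + 48 * g * (k₁ + k₂)) ≤ η / 2)
    {H G : EuclideanSpace ℝ (Fin 3) →L[ℝ] EuclideanSpace ℝ (Fin 3)} (hH : ‖H‖ ≤ B)
    (hεB : ε * (B * (2 * k₁ + k₂ * ((g * (k₁ + k₂) + 1) / Jmin))) ≤ η / 2) :
    ∃ r : EuclideanSpace ℝ (Fin 3),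
      matOp J (ε⁻¹ • v.2) + ε • ((matOp (Γ t) - G) (k₁ • vecPart x.1 + k₂ • (ε⁻¹ • x.2))
          + H (k₁ • vecPart v.1 + k₂ • (ε⁻¹ • v.2)))
        = -(ε • G (k₁ • vecPart x.1 + k₂ • (ε⁻¹ • x.2))) + ε • r ∧
      ‖r‖ ≤ η * (‖vecPart x.1‖ + ‖ε⁻¹ • x.2‖) := by
  obtain ⟨r₁, e₁, hr₁⟩ := h.exists_vecPart_eq hε
  obtain ⟨N, e₂, hN⟩ := h.exists_momentum_eq hε hk₁ hk₂ hx hJmax hJ hg hx1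
  set z := ε⁻¹ • x.2 with hz
  set a := vecPart x.1 with ha
  set n := ‖a‖ + ‖z‖ with hn
  set w := k₁ • a + k₂ • z with hw
  have ha0 := norm_nonneg a
  have hz0 := norm_nonneg z
  have hzn : ‖z‖ ≤ n := by linarith
  have hn0 : 0 ≤ n := by linarith
  have hg0 : 0 ≤ g := (norm_nonneg _).trans hg
  have hB0 : 0 ≤ B := (norm_nonneg _).trans hH
  have hN1 : ‖N‖ ≤ η / 2 * n := hN.trans (by gcongr)
  have hN2 : ‖N‖ ≤ 1 * n := hN1.trans (by gcongr; linarith)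
  have hwn : ‖w‖ ≤ (k₁ + k₂) * n := by
    refine (norm_add_le _ _).trans ?_
    rw [norm_smul, norm_smul, Real.norm_of_nonneg hk₁.le, Real.norm_of_nonneg hk₂.le]
    nlinarith
  have hv1 : ‖vecPart v.1‖ ≤ ε * (2 * n) := by
    have h1 : ‖(ε / 2) • z‖ ≤ ε * n := by
      rw [norm_smul, Real.norm_of_nonneg (half_pos hε).le]
      nlinarith [mul_nonneg hε.le hz0]
    have h2 : ‖ε • r₁‖ ≤ ε * n := by
      rw [norm_smul, Real.norm_of_nonneg hε.le]
      gcongr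
      exact hr₁.trans ((mul_le_of_le_one_left hz0 hx1).trans hzn)
    rw [e₁]
    linarith [norm_add_le ((ε / 2) • z) (ε • r₁)]
  have hv2 : ‖ε⁻¹ • v.2‖ ≤ ε * ((g * (k₁ + k₂) + 1) / Jmin * n) := by
    have h1 := hJ.le_norm (ε⁻¹ • v.2)
    have h2 : ‖matOp J (ε⁻¹ • v.2)‖ ≤ ε * (g * ((k₁ + k₂) * n)) + ε * (1 * n) := by
      rw [e₂]
      refine (norm_add_le _ _).trans (add_le_add ?_ ?_)
      · rw [norm_neg, norm_smul, Real.norm_of_nonneg hε.le]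
        gcongr
        exact ContinuousLinearMap.le_of_opNorm_le_of_le _ hg hwn
      · rw [norm_smul, Real.norm_of_nonneg hε.le]
        gcongr
    have h3 : ‖ε⁻¹ • v.2‖ ≤ (ε * (g * ((k₁ + k₂) * n)) + ε * (1 * n)) / Jmin := by
      rw [le_div_iff₀ hJmin]; linarith
    refine h3.trans (le_of_eq ?_)
    ring
  -- The terms `±ε Γ w` cancel. Half of `η` bounds `N`, by closeness to the target; the other half
  -- bounds `H w'`, where `w' = k₁ a' + k₂ z'` is of order `ε` by `hv1` and `hv2`.
  refine ⟨N + H (k₁ • vecPart v.1 + k₂ • (ε⁻¹ • v.2)), ?_, ?_⟩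
  · rw [e₂, _root_.sub_apply]
    module
  · have h1 : ‖k₁ • vecPart v.1 + k₂ • (ε⁻¹ • v.2)‖
        ≤ k₁ * (ε * (2 * n)) + k₂ * (ε * ((g * (k₁ + k₂) + 1) / Jmin * n)) := by
      refine (norm_add_le _ _).trans (add_le_add ?_ ?_)
      · rw [norm_smul, Real.norm_of_nonneg hk₁.le]; gcongr
      · rw [norm_smul k₂, Real.norm_of_nonneg hk₂.le]; gcongr
    have h2 := ContinuousLinearMap.le_of_opNorm_le_of_le _ hH h1
    have h3 := mul_le_mul_of_nonneg_right hεB hn0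
    have h4 := norm_add_le N (H (k₁ • vecPart v.1 + k₂ • (ε⁻¹ • v.2)))
    linarith

end Perturbation

/-! ### The averaging theorem and the conclusion -/

/-- Averaging: if `Γ` has a positive definite mean and `Γ` minus its mean has a bounded primitive,
then for small gains the closed loop is locally exponentially stable, uniformly in the inertia. -/
theorem exists_locExpStableWith_closedLoop {Γ H : ℝ → Matrix (Fin 3) (Fin 3) ℝ}
    {Γav : Matrix (Fin 3) (Fin 3) ℝ} {C : ℝ} (hΓc : ∀ i j, Continuous fun t => Γ t i j)
    (hH : ∀ t i j, HasDerivAt (fun s => H s i j) (Γ t i j - Γav i j) t)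
    (hHC : ∀ t i j, |H t i j| ≤ C) (hΓC : ∀ t i j, |Γ t i j| ≤ C) (hΓav : Γav.PosDef)
    {k₁ k₂ : ℝ} (hk₁ : 0 < k₁) (hk₂ : 0 < k₂) {Jmin Jmax : ℝ} (hJmin : 0 < Jmin)
    (hJmax : 0 < Jmax) :
    ∃ εs : ℝ, 0 < εs ∧ ∀ ε : ℝ, 0 < ε → ε < εs →
      ∃ c k γ : ℝ, 0 < c ∧ 0 < k ∧ 0 < γ ∧
        ∀ J : Matrix (Fin 3) (Fin 3) ℝ, InertiaBounds Jmin Jmax J →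
          LocExpStableWith (closedLoop J Γ k₁ k₂ ε) unitStates targetState c k γ := by
  obtain ⟨B, hB⟩ : ∃ B, B = C * ∑ i : Fin 3, ∑ j : Fin 3, ‖matOp (Matrix.single i j 1)‖ := ⟨_, rfl⟩
  have hHB : ∀ t, ‖matOp (H t)‖ ≤ B := fun t => hB ▸ norm_matOp_le (hHC t)
  have hΓB : ∀ t, ‖matOp (Γ t)‖ ≤ B := fun t => hB ▸ norm_matOp_le (hΓC t)
  have hB0 : 0 ≤ B := (norm_nonneg _).trans (hHB 0)
  have hH' : ∀ t, HasDerivAt (fun s => matOp (H s)) (matOp (Γ t) - matOp Γav) t := fun t => by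
    rw [← map_sub]; exact hasDerivAt_matOp (hH t)
  obtain ⟨pm, pM, hpm, hpM, hP⟩ := exists_symmBounded_of_posDef hΓav.inv
  obtain ⟨_, gM, -, hgM, hG⟩ := exists_symmBounded_of_posDef hΓav
  have hPG : ∀ y, matOp Γav⁻¹ (matOp Γav y) = y := fun y => by
    have h : matOp Γav⁻¹ * matOp Γav = 1 := by
      rw [matOp, ← map_mul, Matrix.nonsing_inv_mul _ ((Matrix.isUnit_iff_isUnit_det _).1
        hΓav.isUnit), map_one]
    exact DFunLike.congr_fun h y
  obtain ⟨δ, α, β, c, η, hα, hβ, hc, hη, hη1, hlyap⟩ :=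
    exists_lyap_constants hJmin hJmax hpm hpM hgM hk₁ hk₂
      (by positivity : 0 ≤ B * (k₁ + k₂)) hP hG.upper hPG
  obtain ⟨D, hD⟩ : ∃ D, D = B * (2 * k₁ + k₂ * ((B * (k₁ + k₂) + 1) / Jmin)) := ⟨_, rfl⟩
  have hD0 : 0 ≤ D := by rw [hD]; positivity
  -- The first bound serves the Lyapunov constants, the second makes the averaging remainder at most
  -- `η / 2`.
  refine ⟨min η (η / 2 / (D + 1)), lt_min hη (by positivity), fun ε hε hεs => ?_⟩
  have hεη : ε ≤ η := (hεs.trans_le (min_le_left _ _)).le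
  have hε1 : ε ≤ 1 := hεη.trans hη1
  have hεD : ε * D ≤ η / 2 := by
    have h1 := (hεs.trans_le (min_le_right _ _)).le
    rw [le_div_iff₀ (by positivity)] at h1
    nlinarith
  obtain ⟨Q, hQ⟩ : ∃ Q, Q = Jmax / ε + 48 * B * (k₁ + k₂) := ⟨_, rfl⟩
  have hQ0 : 0 ≤ Q := by rw [hQ]; positivity
  -- The radius is chosen after `ε`, since `Q` contains `Jmax / ε`; it makes the nonlinear remainder
  -- at most `η / 2`.
  set r := min η (η / 2 / (Q + 1)) with hr
  have hr0 : 0 < r := lt_min hη (by positivity)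
  have hrη : r ≤ η := min_le_left _ _
  have hrQ : r * Q ≤ η / 2 := by
    have h1 : r ≤ η / 2 / (Q + 1) := min_le_right _ _
    rw [le_div_iff₀ (by positivity)] at h1
    nlinarith
  set κ := 1 + ε⁻¹ with hκ
  have hκ0 : 0 < κ := by positivity
  -- All constants are fixed before `J`. Passing from `‖a‖ + ‖z‖` to the distance from the target
  -- turns `α` into `α / 4` on unit quaternions and `β` into `β κ²`, where `κ` accounts for `z = ε⁻¹
  -- ω`.
  refine ⟨r / (√(β * κ ^ 2 / (α / 4)) + 1), √(β * κ ^ 2 / (α / 4)), ε * c / β / 2, by positivity,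
    by positivity, by positivity, fun J hJ => ?_⟩
  have hJs := hJ.symmBounded hJmin.le hJmax.le
  let V : ℝ → AttState → ℝ := fun t x => lyap (matOp J) (matOp Γav⁻¹) k₁ δ (vecPart x.1)
    (matOp J (ε⁻¹ • x.2) + ε • matOp (H t) (k₁ • vecPart x.1 + k₂ • (ε⁻¹ • x.2)))
  have hwn : ∀ (t : ℝ) (x : AttState), ‖matOp (H t) (k₁ • vecPart x.1 + k₂ • (ε⁻¹ • x.2))‖
      ≤ B * (k₁ + k₂) * (‖vecPart x.1‖ + ‖ε⁻¹ • x.2‖) := fun t x => by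
    rw [mul_assoc]
    refine ContinuousLinearMap.le_of_opNorm_le_of_le _ (hHB t) ((norm_add_le _ _).trans ?_)
    rw [norm_smul k₁, norm_smul k₂, Real.norm_of_nonneg hk₁.le, Real.norm_of_nonneg hk₂.le]
    nlinarith [norm_nonneg (vecPart x.1), norm_nonneg (ε⁻¹ • x.2)]
  have hV : ∀ t x, _ := fun t x => hlyap (matOp J) hJs ε hε hεη _ _ _ (hwn t x)
  refine locExpStableWith_of_lyapunov (V := V) hr0 (by positivity) (by positivity) (by positivity)
    ?_ (fun t₀ T x => closedLoop_mem_unitStates) ?_ ?_ ?_ ?_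
  · have hHc : Continuous fun t => matOp (H t) :=
      continuous_iff_continuousAt.2 fun t => (hH' t).continuousAt
    have h1 : Continuous fun p : ℝ × AttState => vecPart p.2.1 := by fun_prop
    have h2 : Continuous fun p : ℝ × AttState => ε⁻¹ • p.2.2 := by fun_prop
    have h3 := ((matOp J).continuous.comp h2).add
      (((hHc.comp continuous_fst).clm_apply ((h1.const_smul k₁).add (h2.const_smul k₂))).const_smul
        ε)
    have h4 := (matOp J).continuous.comp h1
    have h5 := (matOp Γav⁻¹).continuous.comp h3
    exact ((continuous_const.mul (h5.inner h3)).add (continuous_const.mul (h4.inner h1))).add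
      (continuous_const.mul (h4.inner h5))
  · intro t x hx hxr
    refine le_trans ?_ (hV t x).1
    have h1 := norm_sub_targetState_le hx (hxr.trans (hrη.trans hη1))
    have h2 : ‖x.2‖ ≤ ‖ε⁻¹ • x.2‖ := by
      rw [norm_smul, norm_inv, Real.norm_of_nonneg hε.le]
      exact le_mul_of_one_le_left (norm_nonneg _) ((one_le_inv₀ hε).2 hε1)
    have h3 : ‖x - targetState‖ ≤ 2 * (‖vecPart x.1‖ + ‖ε⁻¹ • x.2‖) := by
      linarith [norm_nonneg (ε⁻¹ • x.2)]
    calc α / 4 * ‖x - targetState‖ ^ 2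
        ≤ α / 4 * (2 * (‖vecPart x.1‖ + ‖ε⁻¹ • x.2‖)) ^ 2 := by gcongr
      _ = _ := by ring
  · intro t x
    refine (hV t x).2.1.trans ?_
    have h1 : ‖vecPart x.1‖ + ‖ε⁻¹ • x.2‖ ≤ κ * ‖x - targetState‖ := by
      rw [norm_smul, norm_inv, Real.norm_of_nonneg hε.le, hκ, add_mul, one_mul]
      gcongr
      exacts [norm_vecPart_le_norm_sub_targetState x, norm_snd_le_norm_sub_targetState x]
    calc β * (‖vecPart x.1‖ + ‖ε⁻¹ • x.2‖) ^ 2 ≤ β * (κ * ‖x - targetState‖) ^ 2 := by gcongr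
      _ = _ := by ring
  · intro x t v hv hx hxr hF
    have ha : HasDerivAt (fun s => vecPart (x s).1) (vecPart v.1) t :=
      (vecPart.comp (ContinuousLinearMap.fst ℝ (EuclideanSpace ℝ (Fin 4))
        (EuclideanSpace ℝ (Fin 3)))).hasFDerivAt.comp_hasDerivAt t hv
    have hz : HasDerivAt (fun s => ε⁻¹ • (x s).2) (ε⁻¹ • v.2) t :=
      (ε⁻¹ • ContinuousLinearMap.snd ℝ (EuclideanSpace ℝ (Fin 4))
        (EuclideanSpace ℝ (Fin 3))).hasFDerivAt.comp_hasDerivAt t hv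
    have hy := ((matOp J).hasFDerivAt.comp_hasDerivAt t hz).add
      (((hH' t).clm_apply ((ha.const_smul k₁).add (hz.const_smul k₂))).const_smul ε)
    refine ⟨_, hasDerivAt_lyap hJs.symm hP.symm k₁ δ ha hy, ?_⟩
    have hx1 : ‖x t - targetState‖ ≤ 1 := hxr.le.trans (hrη.trans hη1)
    obtain ⟨r₁, e₁, hr₁⟩ := hF.exists_vecPart_eq hε
    obtain ⟨r₂, e₂, hr₂⟩ := hF.exists_averaged_eq hε hk₁ hk₂ hx hJmin hJmax.le hJs (hΓB t) hx1 hη1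
      (by rw [← hQ]; exact (mul_le_mul_of_nonneg_right hxr.le hQ0).trans hrQ) (G := matOp Γav)
      (hHB t) (by rw [← hD]; exact hεD)
    have hr₁' : ‖r₁‖ ≤ η * (‖vecPart (x t).1‖ + ‖ε⁻¹ • (x t).2‖) := by
      refine hr₁.trans ?_
      gcongr
      · exact hxr.le.trans hrη
      · linarith [norm_nonneg (vecPart (x t).1)]
    have h1 := (hV t (x t)).2.2 r₁ r₂ hr₁' hr₂
    rw [← e₁, ← e₂] at h1
    refine h1.trans ?_
    -- The upper bound by `β` converts decay in terms of `(‖a‖ + ‖z‖)²` into decay in terms of `V`,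
    -- at rate `ε c / β`.
    have h2 := mul_le_mul_of_nonneg_left (hV t (x t)).2.1 (by positivity : 0 ≤ ε * c / β)
    have h3 : ε * c / β * (β * (‖vecPart (x t).1‖ + ‖ε⁻¹ • (x t).2‖) ^ 2)
        = ε * c * (‖vecPart (x t).1‖ + ‖ε⁻¹ • (x t).2‖) ^ 2 := by field_simp
    change _ ≤ -(ε * c / β) * lyap _ _ _ _ _ _
    linarith
  · intro t₀ ξ
    have hγ : Continuous fun t => (Γ t : Fin 3 → Fin 3 → ℝ) :=
      continuous_pi fun i => continuous_pi fun j => hΓc i j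
    have hC0 : 0 ≤ C := (abs_nonneg _).trans (hΓC 0 0 0)
    obtain ⟨x, hx0, hx⟩ := exists_curve_solution_in_ball (contDiff_closedLoopField J k₁ k₂ ε) hγ
      (C := C) (fun t => (pi_norm_le_iff_of_nonneg hC0).2 fun i =>
        (pi_norm_le_iff_of_nonneg hC0).2 fun j => hΓC t i j) r targetState t₀ ξ
    refine ⟨x, hx0, fun t ht => ?_⟩
    obtain ⟨v, hv, hv'⟩ := hx t ht
    refine ⟨v, hv, fun hlt => ?_⟩
    rw [hv' hlt]
    exact closedLoop_closedLoopField (hJ.isUnit_det hJmin) Γ k₁ k₂ ε t (x t)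

theorem theorem1 (p : OrbitField) (hdipole : 0 < p.dipole) (hradius : 0 < p.radius)
    (k₁ k₂ : ℝ) (hk₁ : 0 < k₁) (hk₂ : 0 < k₂)
    (Jmin Jmax : ℝ) (hJmin : 0 < Jmin) (hJmax : Jmin ≤ Jmax) :
    ∃ Γav : Matrix (Fin 3) (Fin 3) ℝ, Tendsto p.gammaMean atTop (𝓝 Γav) ∧
      (Γav.PosDef →
        ∃ εs : ℝ, 0 < εs ∧ ∀ ε : ℝ, 0 < ε → ε < εs →
          ∃ c k γ : ℝ, 0 < c ∧ 0 < k ∧ 0 < γ ∧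
            ∀ J : Matrix (Fin 3) (Fin 3) ℝ, InertiaBounds Jmin Jmax J →
              LocExpStableWith (closedLoop J p.gamma k₁ k₂ ε) unitStates targetState c k γ) := by
  obtain ⟨Γav, hlim, C, H, hH, hHC, hΓC⟩ := p.exists_gammaMean hradius
  exact ⟨Γav, hlim, fun hpos => exists_locExpStableWith_closedLoop
    (fun i j => (p.isTrigPoly_gamma hradius i j).continuous) hH hHC hΓC hpos hk₁ hk₂ hJmin
    (hJmin.trans_le hJmax)⟩
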